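/- All semigroups and transformation semigroups are finite. A transformation semigroup (ts) $(Q,S)$ is a finite set $Q$ with a subsemigroup $S$ of the semigroup of all partial transformations of $Q$, acting on the right. The wreath product $(P,T)\wr(Q,S)$ has states $P\times Q$ and consists of the partial transformations $(p,q)(f,s)=(p(qf),qs)$, defined when $qs$ and $p(qf)$ are, with $s\in S$ and $f:\mathrm{Dom}(s)\to T$; the direct product $(P,T)\times(Q,S)$ has states $P\times Q$ and consists of the partial transformations $(p,q)(t,s)=(pt,qs)$, $t\in T$, $s\in S$. A ts $(P,T)$ divides a ts $(Q,S)$, written $(P,T)\prec(Q,S)$, if there is a surjective partial function $\varphi:Q\to P$ such that for every $t\in T$ there is $s\in S$ such that, for all $q\in Q$, whenever $(q\varphi)t$ is defined, $(qs)\varphi$ is defined and equal to it. A group $H$ is regarded as the ts $(H,H)$ given by right translations. A semigroup divides another one if it is a homomorphic image of a subsemigroup of it. The (Krohn–Rhodes) complexity $Sc$ of a semigroup $S$ is the least number of group factors in an iterated wreath product of groups and aperiodic transformation semigroups whose semigroup is divided by $S$; the complexity of a ts is that of its semigroup. Let $S$ be a group mapping ($\mathrm{GM}$) semigroup: $S$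 has a faithful transitive right action by partial transformations on a nonempty set and a faithful transitive left action by partial transformations on a nonempty set, and its $0$-minimal regular ideal $I(S)\cong M^0(G,A,B,C)$ (the minimal ideal $M(G,A,B,C)$, if $S$ has no zero) has a non-trivial maximal subgroup $G$. Fix $a\in A$ and identify the $\mathcal R$-class $\{a\}\times G\times B$ of $I(S)$ with $G\times B$. Let $(G\times B,S)$ be the resulting ts, in which $(g,b)s=(g',b')$ if $(a,g,b)s=(a,g',b')$ in $S$, and $(g,b)s$ is undefined if $(a,g,b)s$ is not in the $\mathcal R$-class. Let $(B,\mathrm{RLM}(S))$ be the ts of the partial transformations of $B$ induced by the elements of $S$: $bs=b'$ if and only if $(g,b)s=(g',b')$ for some $g,g'\in G$. **Theorem.** Let $(G\times B,S)$ be a $\mathrm{GM}$ transformation semigroup and let $k>0$ be an integer. Then $Sc\le k$ if and only if $\mathrm{RLM}(S)c\le k$ and there are a transformation semigroup $T$ with $Tc\le k-1$ and a group $H$ such that $$(G\times B,S)\prec (H\wr T)\times(B,\mathrm{RLM}(S)).$$ -/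

import Mathlib

namespace KRho

universe u v w x

/-! ### Partial transformations and transformation semigroups -/

/-- Partial transformations of `Q`, acting on the right: `f q = some q'` means `q f = q'`,
`f q = none` means that `q f` is undefined. -/
@[ext]
structure PT (Q : Type u) : Type u where
  app : Q → Option Q

instance PT.instCoeFun (Q : Type u) : CoeFun (PT Q) fun _ => Q → Option Q := ⟨PT.app⟩

/-- Composition of right actions: `q (f * g) = (q f) g`. -/
instance PT.instSemigroup (Q : Type u) : Semigroup (PT Q) where
  mul f g := ⟨fun q => (f q).bind g⟩
  mul_assoc f g h := by
    ext1
    funext q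
    change ((f q).bind g).bind h = (f q).bind fun r => (g r).bind h
    cases f q <;> rfl

theorem PT.mul_apply {Q : Type u} (f g : PT Q) (q : Q) : (f * g) q = (f q).bind g := rfl

/-- A finite transformation semigroup `(Q, S)`: a finite set `Q` and a subsemigroup `S` of the
semigroup of all partial transformations of `Q`. -/
structure TS : Type (u + 1) where
  State : Type u
  finite : Finite State
  semi : Subsemigroup (PT State)

/-- The action of the pair `(f, s)` on `P × Q`: `(p, q)(f, s) = (p (q f), q s)`, defined whenever
`q s` and `p (q f)` are. -/
def wreathAct {P : Type u} {Q : Type v} (f : Q → PT P) (s : PT Q) : PT (P × Q) :=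
  ⟨fun z => (s z.2).bind fun q' => (f z.2 z.1).map fun p' => (p', q')⟩

/-- The wreath product `(P, T) ≀ (Q, S)`: the states are `P × Q`, and the transformations are those
of the pairs `(f, s)` with `s ∈ S` and `f : Dom s → T`. (The values of `f` off `Dom s` play no
role.) -/
def TS.wreath (X : TS.{u}) (Y : TS.{v}) : TS.{max u v} where
  State := X.State × Y.State
  finite := by
    have := X.finite
    have := Y.finite
    infer_instance
  semi :=
    { carrier := {h | ∃ s ∈ Y.semi, ∃ f : Y.State → PT X.State,
        (∀ q, (s q).isSome → f q ∈ X.semi) ∧ h = wreathAct f s}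
      mul_mem' := by
        rintro _ _ ⟨s, hs, f, hf, rfl⟩ ⟨t, ht, g, hg, rfl⟩
        refine ⟨s * t, Y.semi.mul_mem hs ht,
          fun q => (s q).elim (f q) fun q' => f q * g q', ?_, ?_⟩
        · intro q hq
          rw [PT.mul_apply] at hq
          cases hsq : s q with
          | none => simp [hsq] at hq
          | some q' =>
            rw [hsq] at hq
            simpa [hsq] using X.semi.mul_mem (hf q (by simp [hsq])) (hg q' hq)
        · ext1
          funext z
          obtain ⟨p, q⟩ := z
          simp only [PT.mul_apply, wreathAct]
          cases hsq : s q with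
          | none => simp
          | some q' =>
            cases hfp : f q p with
            | none => cases ht : t q' <;> simp [PT.mul_apply, hfp, ht]
            | some p' => simp [PT.mul_apply, hfp] }

/-- The action of the pair `(t, s)` on `P × Q`: `(p, q)(t, s) = (p t, q s)`, defined whenever both
components are. -/
def prodAct {P : Type u} {Q : Type v} (t : PT P) (s : PT Q) : PT (P × Q) :=
  ⟨fun z => (t z.1).bind fun p' => (s z.2).map fun q' => (p', q')⟩

/-- The direct product `(P, T) × (Q, S)`. -/
def TS.prod (X : TS.{u}) (Y : TS.{v}) : TS.{max u v} where
  State := X.State × Y.State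
  finite := by
    have := X.finite
    have := Y.finite
    infer_instance
  semi :=
    { carrier := {h | ∃ t ∈ X.semi, ∃ s ∈ Y.semi, h = prodAct t s}
      mul_mem' := by
        rintro _ _ ⟨t, ht, s, hs, rfl⟩ ⟨t', ht', s', hs', rfl⟩
        refine ⟨t * t', X.semi.mul_mem ht ht', s * s', Y.semi.mul_mem hs hs', ?_⟩
        ext1
        funext z
        obtain ⟨p, q⟩ := z
        simp only [PT.mul_apply, prodAct]
        cases htp : t p with
        | none => simp
        | some p' =>
          cases hsq : s q with
          | none => cases t' p' <;> simp
          | some q' => simp }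

/-- Division `X ≺ Y` of transformation semigroups (Eilenberg): there is a surjective partial
function `φ` from the states of `Y` onto the states of `X` such that every transformation `s` of
`X` is covered by some transformation `t` of `Y`: whenever `(y φ) s` is defined, so is `(y t) φ`,
and they are equal. -/
def TS.Divides (X : TS.{u}) (Y : TS.{v}) : Prop :=
  ∃ φ : Y.State → Option X.State,
    (∀ p, ∃ y, φ y = some p) ∧
    ∀ s ∈ X.semi, ∃ t ∈ Y.semi, ∀ y p p', φ y = some p → s p = some p' →
      ∃ y', t y = some y' ∧ φ y' = some p'

/-- The group `H` as a transformation semigroup `(H, H)`, acting on itself by right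
translations. -/
def groupTS (H : Type u) [Group H] (hH : Finite H) : TS.{u} where
  State := H
  finite := hH
  semi :=
    { carrier := {f | ∃ h : H, f = ⟨fun y => some (y * h)⟩}
      mul_mem' := by
        rintro _ _ ⟨h, rfl⟩ ⟨k, rfl⟩
        refine ⟨h * k, ?_⟩
        ext1
        funext y
        simp [PT.mul_apply, mul_assoc] }

/-! ### Complexity -/

/-- Division of semigroups: `S` is a homomorphic image of a subsemigroup of `T`. -/
def SemigroupDivides (S : Type u) (T : Type v) [Semigroup S] [Semigroup T] : Prop :=
  ∃ (V : Subsemigroup T) (θ : V →ₙ* S), Function.Surjective θ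

/-- A semigroup is aperiodic if all its subgroups are trivial: for every idempotent `e`, the only
`x` with `e x = x = x e` which is invertible with respect to `e` is `e` itself. -/
def IsAperiodic (S : Type u) [Semigroup S] : Prop :=
  ∀ e x y : S, e * e = e → e * x = x → x * e = x → e * y = y → y * e = y →
    x * y = e → y * x = e → x = e

/-- `IsIteratedWreath n W`: the transformation semigroup `W` is an iterated wreath product
`F₁ ≀ (F₂ ≀ (⋯ ≀ F_r))`, `r ≥ 1`, of finite groups and finite aperiodic transformation semigroups,
in which exactly `n` of the factors are groups. -/
inductive IsIteratedWreath : ℕ → TS.{0} → Prop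
  | aperiodic (A : TS.{0}) (hA : IsAperiodic A.semi) : IsIteratedWreath 0 A
  | group (H : Type) [Group H] (hH : Finite H) : IsIteratedWreath 1 (groupTS H hH)
  | aperiodic_wreath {n : ℕ} (A : TS.{0}) (hA : IsAperiodic A.semi) {W : TS.{0}}
      (hW : IsIteratedWreath n W) : IsIteratedWreath n (A.wreath W)
  | group_wreath {n : ℕ} (H : Type) [Group H] (hH : Finite H) {W : TS.{0}}
      (hW : IsIteratedWreath n W) : IsIteratedWreath (n + 1) ((groupTS H hH).wreath W)

/-- The (Krohn-Rhodes) complexity `Sc` of a finite semigroup: the least number of group factors in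
an iterated wreath product of finite groups and finite aperiodic transformation semigroups which
`S` divides. -/
noncomputable def complexity (S : Type u) [Semigroup S] : ℕ∞ :=
  sInf {c | ∃ (n : ℕ) (W : TS.{0}), IsIteratedWreath n W ∧ SemigroupDivides S W.semi ∧ c = n}

/-- The complexity of a transformation semigroup is the complexity of its semigroup. -/
noncomputable def TS.complexity (X : TS.{u}) : ℕ∞ := KRho.complexity X.semi

/-! ### Generalized group mapping semigroups -/

/-- `S` has a faithful transitive right action by partial transformations on some nonempty set. -/
def IsRightMapping (S : Type u) [Semigroup S] : Prop :=
  ∃ (X : Type u) (ρ : S →ₙ* PT X), Nonempty X ∧ Function.Injective ρ ∧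
    ∀ y z, ∃ s, ρ s y = some z

/-- `S` has a faithful transitive left action by partial transformations on some nonempty set; a
left action of `S` is a right action of the opposite semigroup. -/
def IsLeftMapping (S : Type u) [Semigroup S] : Prop := IsRightMapping Sᵐᵒᵖ

/-- Generalized group mapping (bi-transitive) semigroups. -/
def IsGGM (S : Type u) [Semigroup S] : Prop := IsRightMapping S ∧ IsLeftMapping S

/-- `z` is the zero of `S`. -/
def IsZeroElt {S : Type u} [Semigroup S] (z : S) : Prop := ∀ s, z * s = z ∧ s * z = z

/-- Two-sided (nonempty) ideals. -/
def IsIdeal {S : Type u} [Semigroup S] (I : Set S) : Prop :=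
  I.Nonempty ∧ ∀ y ∈ I, ∀ s, y * s ∈ I ∧ s * y ∈ I

/-- `0`-minimal ideals: minimal among the ideals that are not just the zero. If `S` has no zero,
this is the minimal ideal. -/
def IsZeroMinimalIdeal {S : Type u} [Semigroup S] (I : Set S) : Prop :=
  IsIdeal I ∧ (∃ y ∈ I, ¬ IsZeroElt y) ∧
    ∀ J : Set S, IsIdeal J → J ⊆ I → (∀ y ∈ J, IsZeroElt y) ∨ J = I

/-- The product of two nonzero elements of the Rees matrix semigroup `M⁰(G, A, B, C)`:
`(a, g, b)(a', g', b') = (a, g C(b,a') g', b')` if `C(b,a') ≠ 0`, and `0` (that is, `none`) if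
`C(b,a') = 0`. -/
def reesMul {G : Type v} {A : Type w} {B : Type x} [Group G] (C : B → A → Option G)
    (y z : A × G × B) : Option (A × G × B) :=
  (C y.2.2 z.1).map fun c => (y.1, y.2.1 * c * z.2.1, z.2.2)

/-- An identification of a regular `0`-minimal ideal `I(S)` of `S` with a regular Rees matrix
semigroup `M⁰(G, A, B, C)` over the group `G` (or with `M(G, A, B, C)`, if `S` has no zero; then
`C` has no zero entry). Zero entries of the sandwich matrix `C` are written `none`. -/
structure ReesCoordinates (S : Type u) (G : Type v) (A : Type w) (B : Type x)
    [Semigroup S] [Group G] where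
  /-- the sandwich matrix -/
  C : B → A → Option G
  row_regular : ∀ b, ∃ a, C b a ≠ none
  col_regular : ∀ a, ∃ b, C b a ≠ none
  /-- the element of `S` with coordinates `(a, g, b)` -/
  elt : A × G × B → S
  elt_injective : Function.Injective elt
  elt_ne_zero : ∀ y, ¬ IsZeroElt (elt y)
  mul_some : ∀ y z t, reesMul C y z = some t → elt y * elt z = elt t
  mul_none : ∀ y z, reesMul C y z = none → IsZeroElt (elt y * elt z)
  /-- the image, together with the zero of `S` if there is one, is a `0`-minimal ideal -/
  zeroMinimal : IsZeroMinimalIdeal {s : S | s ∈ Set.range elt ∨ IsZeroElt s}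

namespace ReesCoordinates

variable {S : Type u} {G : Type v} {A : Type w} {B : Type x} [Semigroup S] [Group G]

/-- For a point `(a, g, b)` and `s ∈ S`, the product is `0` or stays in the same `ℛ`-class. -/
theorem mul_cases (D : ReesCoordinates S G A B) (a : A) (z : G × B) (s : S) :
    (∃ z' : G × B, D.elt (a, z) * s = D.elt (a, z')) ∨ IsZeroElt (D.elt (a, z) * s) := by
  obtain ⟨b₀, hb₀⟩ := D.col_regular a
  obtain ⟨c, hc⟩ := Option.ne_none_iff_exists'.mp hb₀
  have he : D.elt (a, c⁻¹, b₀) * D.elt (a, z) = D.elt (a, z) :=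
    D.mul_some _ _ _ (by simp [reesMul, hc])
  rcases (D.zeroMinimal.1.2 (D.elt (a, z)) (Or.inl ⟨_, rfl⟩) s).1 with ⟨⟨a', z'⟩, h⟩ | h
  · have h1 : D.elt (a, c⁻¹, b₀) * D.elt (a', z') = D.elt (a, z) * s := by
      rw [h, ← mul_assoc, he]
    cases hr : reesMul D.C (a, c⁻¹, b₀) (a', z') with
    | none =>
      right
      rw [← h1]
      exact D.mul_none _ _ hr
    | some t =>
      left
      obtain ⟨c', _, rfl⟩ := Option.map_eq_some_iff.mp hr
      exact ⟨_, h1.symm.trans (D.mul_some _ _ _ hr)⟩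
  · exact Or.inr h

open Classical in
/-- The right Schützenberger action of `s ∈ S` on the `ℛ`-class `{a} × G × B` of `I(S)`, which is
identified with `G × B`: `(g, b) s = (g', b')` if `(a, g, b) s = (a, g', b')`, and `(g, b) s` is
undefined if `(a, g, b) s` is outside the `ℛ`-class. -/
noncomputable def actFun (D : ReesCoordinates S G A B) (a : A) (s : S) : PT (G × B) :=
  ⟨fun z => if h : ∃ z' : G × B, D.elt (a, z) * s = D.elt (a, z') then some h.choose else none⟩

theorem actFun_eq_some (D : ReesCoordinates S G A B) (a : A) (s : S) (z z' : G × B) :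
    D.actFun a s z = some z' ↔ D.elt (a, z) * s = D.elt (a, z') := by
  simp only [actFun]
  split_ifs with h
  · rw [Option.some_inj]
    constructor
    · rintro rfl
      exact h.choose_spec
    · intro h'
      have := D.elt_injective (h.choose_spec.symm.trans h')
      simpa using this
  · simp only [false_iff]
    exact fun h' => h ⟨z', h'⟩

theorem actFun_mul (D : ReesCoordinates S G A B) (a : A) (s t : S) :
    D.actFun a (s * t) = D.actFun a s * D.actFun a t := by
  ext1
  funext z
  refine Option.ext fun z' => ?_
  rw [D.actFun_eq_some, PT.mul_apply, Option.bind_eq_some_iff, ← mul_assoc]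
  constructor
  · intro h
    rcases D.mul_cases a z s with ⟨y, hy⟩ | hz
    · exact ⟨y, (D.actFun_eq_some ..).2 hy, (D.actFun_eq_some ..).2 (hy ▸ h)⟩
    · rw [(hz t).1] at h
      exact absurd (h ▸ hz) (D.elt_ne_zero _)
  · rintro ⟨y, hy, hy'⟩
    rw [(D.actFun_eq_some ..).1 hy, (D.actFun_eq_some ..).1 hy']

/-- The action of `S` on `G × B`. -/
noncomputable def act (D : ReesCoordinates S G A B) (a : A) : S →ₙ* PT (G × B) where
  toFun := D.actFun a
  map_mul' := D.actFun_mul a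

/-- The action commutes with the left translations of `G`. -/
theorem actFun_smul (D : ReesCoordinates S G A B) (a : A) (s : S) (g h g' : G) (b b' : B)
    (hs : D.actFun a s (g, b) = some (g', b')) :
    D.actFun a s (h * g, b) = some (h * g', b') := by
  rw [D.actFun_eq_some] at hs ⊢
  obtain ⟨b₀, hb₀⟩ := D.col_regular a
  obtain ⟨c, hc⟩ := Option.ne_none_iff_exists'.mp hb₀
  have he : ∀ k d, D.elt (a, h * c⁻¹, b₀) * D.elt (a, k, d) = D.elt (a, h * k, d) := fun k d =>
    D.mul_some _ _ _ (by simp [reesMul, hc])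
  rw [← he, mul_assoc, hs, he]

/-- The action of `S` on `B` induced by the action on `G × B`: `b s = b'` if
`(g, b) s = (g', b')` for some (equivalently, for every) `g`. -/
noncomputable def rlmFun (D : ReesCoordinates S G A B) (a : A) (s : S) : PT B :=
  ⟨fun b => (D.actFun a s (1, b)).map Prod.snd⟩

theorem rlmFun_eq_some (D : ReesCoordinates S G A B) (a : A) (s : S) (g : G) (b b' : B) :
    D.rlmFun a s b = some b' ↔ ∃ g', D.actFun a s (g, b) = some (g', b') := by
  unfold rlmFun
  rw [Option.map_eq_some_iff]
  constructor
  · rintro ⟨⟨g', _⟩, h, rfl⟩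
    exact ⟨g * g', by simpa using D.actFun_smul a s 1 g g' b _ h⟩
  · rintro ⟨g', h⟩
    exact ⟨(g⁻¹ * g', b'), by simpa using D.actFun_smul a s g g⁻¹ g' b _ h, rfl⟩

theorem rlmFun_mul (D : ReesCoordinates S G A B) (a : A) (s t : S) :
    D.rlmFun a (s * t) = D.rlmFun a s * D.rlmFun a t := by
  ext1
  funext b
  refine Option.ext fun b' => ?_
  rw [D.rlmFun_eq_some a _ 1, PT.mul_apply, Option.bind_eq_some_iff, D.actFun_mul]
  simp only [PT.mul_apply, Option.bind_eq_some_iff]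
  constructor
  · rintro ⟨g', ⟨g₁, b₁⟩, h, h'⟩
    exact ⟨b₁, (D.rlmFun_eq_some a s 1 b b₁).2 ⟨g₁, h⟩, (D.rlmFun_eq_some a t g₁ b₁ b').2 ⟨g', h'⟩⟩
  · rintro ⟨b₁, h, h'⟩
    obtain ⟨g₁, h₁⟩ := (D.rlmFun_eq_some a s 1 b b₁).1 h
    obtain ⟨g₂, h₂⟩ := (D.rlmFun_eq_some a t g₁ b₁ b').1 h'
    exact ⟨g₂, (g₁, b₁), h₁, h₂⟩

/-- The morphism from `S` onto its right letter mapping image. -/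
noncomputable def rlm (D : ReesCoordinates S G A B) (a : A) : S →ₙ* PT B where
  toFun := D.rlmFun a
  map_mul' := D.rlmFun_mul a

/-- The transformation semigroup `(G × B, S)` of the `ℛ`-class with index `a`. -/
noncomputable def ts [Finite S] (D : ReesCoordinates S G A B) (a : A) : TS where
  State := G × B
  finite := Finite.of_injective (fun z => D.elt (a, z)) fun y z h => by
    simpa using D.elt_injective h
  semi := (D.act a).srange

/-- The right letter mapping transformation semigroup `(B, RLM(S))`: the faithful image of the
action of `S` on `B`. -/
noncomputable def rlmTS [Finite S] (D : ReesCoordinates S G A B) (a : A) : TS where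
  State := B
  finite := Finite.of_injective (fun b => D.elt (a, 1, b)) fun y z h => by
    simpa using D.elt_injective h
  semi := (D.rlm a).srange

end ReesCoordinates

end KRho

/-!
Both implications are elementary once semigroup division is translated into division of
transformation semigroups and back.

*From complexity to a division.* Let `S` divide an iterated wreath product with `n ≤ k` group
factors. Stripping the aperiodic factors to the left of the leftmost group `H` leaves `H ≀ Y`,
where `Y` has at most `n - 1` group factors; let `N` be the semigroup of pairs `(f, t)` which
define the transformations of `H ≀ Y` (`Cocycle`). There is a relational morphism from `S` to `N`
such that the elements of `S` related to an idempotent form an aperiodic semigroup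
(`IsIteratedWreath.exists_isAperiodicRel`). If two points `(a, g, b)`, `(a, g', b)` of the
`ℛ`-class are related to the same `n ∈ N`, then right multiplication by a suitable element takes
them to two elements of one maximal subgroup which are related to one idempotent; both are the
identity, hence `g = g'` (`ReesCoordinates.eq_of_isAperiodicRel`). So `(n, b) ↦ (g, b)` is a
well-defined partial function, and it shows that `(G × B, S)` divides the product of `N`, acting
on itself, and `(B, RLM(S))`. The action of `N` on itself is part of a wreath product of the group
of functions from the states of `Y` to `H` with the right regular action of the semigroup of `Y`.

*From a division to complexity.* A transformation semigroup whose semigroup divides an iterated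
wreath product also divides, as a transformation semigroup, one with as many group factors
(`IsIteratedWreath.exists_divides`): its states are represented by tuples of states, on which the
action is diagonal. Direct products of iterated wreath products can be merged factor by factor,
the groups in pairs (`IsIteratedWreath.exists_prod_divides`). Conversely, division of
transformation semigroups gives division of semigroups after an aperiodic factor has been added
which makes covers exact (`TS.Divides.semigroupDivides`). Finally, a right mapping semigroup acts
faithfully on the `ℛ`-class (`ReesCoordinates.act_injective`), so that `S` is the semigroup
of `(G × B, S)`.
-/

namespace KRho

universe u v w x

/-! ### Powers in a semigroup and aperiodicity -/

/-- The power `x ^ (n + 1)` in a semigroup; the exponent is shifted because a semigroup has no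
zeroth power. -/
def spow {S : Type u} [Semigroup S] (y : S) : ℕ → S
  | 0 => y
  | n + 1 => spow y n * y

/-- Some power of `y` is unchanged by a further multiplication with `y`. -/
def PowStable {S : Type u} [Semigroup S] (y : S) : Prop := ∃ m, spow y m = spow y (m + 1)

section Powers

variable {S : Type u} {T : Type v} [Semigroup S] [Semigroup T]

theorem spow_succ (y : S) (n : ℕ) : spow y (n + 1) = spow y n * y := rfl

theorem spow_mul_spow (y : S) (m n : ℕ) : spow y m * spow y n = spow y (m + n + 1) := by
  induction n with
  | zero => rfl
  | succ n ih => rw [spow_succ, ← mul_assoc, ih]; rfl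

theorem map_spow (θ : T →ₙ* S) (y : T) (n : ℕ) : θ (spow y n) = spow (θ y) n := by
  induction n with
  | zero => rfl
  | succ n ih => rw [spow_succ, spow_succ, map_mul, ih]

theorem spow_eq_of_le {y : S} {m : ℕ} (h : spow y m = spow y (m + 1)) {n : ℕ} (hn : m ≤ n) :
    spow y n = spow y m := by
  induction n, hn using Nat.le_induction with
  | base => rfl
  | succ n _ ih => rw [spow_succ, ih, ← spow_succ, ← h]

theorem spow_eq_spow_succ_of_le {y : S} {m : ℕ} (h : spow y m = spow y (m + 1)) {n : ℕ}
    (hn : m ≤ n) : spow y n = spow y (n + 1) := by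
  rw [spow_eq_of_le h hn, spow_eq_of_le h (hn.trans n.le_succ)]

theorem PowStable.map (θ : T →ₙ* S) {y : T} : PowStable y → PowStable (θ y) := by
  rintro ⟨m, hm⟩
  exact ⟨m, by rw [← map_spow, ← map_spow, hm]⟩

theorem powStable_of_mul_self {y : S} (h : y * y = y) : PowStable y := ⟨0, h.symm⟩

theorem exists_spow_idempotent [Finite S] (y : S) : ∃ m, spow y m * spow y m = spow y m := by
  obtain ⟨i, j, hij, h⟩ := Finite.exists_ne_map_eq_of_infinite (spow y)
  wlog hlt : i < j generalizing i j
  · exact this j i hij.symm h.symm (by omega)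
  obtain ⟨p, rfl⟩ := Nat.exists_eq_add_of_lt hlt
  have hper : ∀ n, i ≤ n → spow y (n + (p + 1)) = spow y n := by
    intro n hn
    induction n, hn using Nat.le_induction with
    | base => exact h.symm
    | succ n _ ih =>
      rw [show n + 1 + (p + 1) = n + (p + 1) + 1 by ring, spow_succ, ih, spow_succ]
  have hper' : ∀ r n, i ≤ n → spow y (n + r * (p + 1)) = spow y n := by
    intro r
    induction r with
    | zero => intro n _; simp
    | succ r ih =>
      intro n hn
      rw [show n + (r + 1) * (p + 1) = n + r * (p + 1) + (p + 1) by ring,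
        hper _ (by omega), ih n hn]
  -- the exponent `(i + 1) * (p + 1)` is a multiple of the period beyond the preperiod
  refine ⟨i + (i + 1) * p, ?_⟩
  rw [spow_mul_spow]
  have := hper' (i + 1) (i + (i + 1) * p) (by omega)
  rw [← this]
  congr 1
  ring

theorem IsAperiodic.powStable [Finite S] (hS : IsAperiodic S) (y : S) : PowStable y := by
  obtain ⟨m, hm⟩ := exists_spow_idempotent y
  refine ⟨m, ?_⟩
  have hm' : spow y (m + m + 1) = spow y m := by rw [← spow_mul_spow, hm]
  have h3 : spow y (m + 1) * spow y (m + m) = spow y m := by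
    rw [spow_mul_spow, show m + 1 + (m + m) + 1 = m + (m + m + 1) + 1 by ring, ← spow_mul_spow,
      hm', hm]
  have hc : ∀ i, spow y m * spow y (m + i) = spow y (m + i) := by
    intro i
    rw [spow_mul_spow, show m + (m + i) + 1 = m + m + 1 + i by ring]
    cases i with
    | zero => exact hm'
    | succ i => rw [← add_assoc, ← spow_mul_spow, hm', spow_mul_spow, ← add_assoc]
  have hc' : ∀ i, spow y (m + i) * spow y m = spow y (m + i) := fun i => by
    rw [spow_mul_spow, add_comm (m + i) m, ← spow_mul_spow, hc]
  refine (hS _ (spow y (m + 1)) (spow y (m + m)) hm (hc 1) (hc' 1) (hc m) (hc' m) h3 ?_).symm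
  rw [spow_mul_spow, add_comm (m + m), ← spow_mul_spow, h3]

theorem isAperiodic_of_powStable (h : ∀ y : S, PowStable y) : IsAperiodic S := by
  intro e y z _ hey hye _ _ hyz _
  obtain ⟨m, hm⟩ := h y
  induction m with
  | zero =>
    change y = y * y at hm
    rw [← hyz, ← mul_assoc, ← hm] at hye
    rw [← hyz, hye]
  | succ m ih =>
    have hlast : ∀ n, spow y n * e = spow y n := by
      intro n
      cases n with
      | zero => exact hye
      | succ n => rw [spow_succ, mul_assoc, hye]
    have := congrArg (· * z) hm
    simp only [spow_succ _ (m + 1), spow_succ _ m, mul_assoc, hyz, hye, hlast] at this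
    exact ih this

theorem SemigroupDivides.refl : SemigroupDivides S S :=
  ⟨⊤, ⟨fun y => y.1, fun _ _ => rfl⟩, fun y => ⟨⟨y, trivial⟩, rfl⟩⟩

/-- A quotient of a divisor is a divisor. -/
theorem SemigroupDivides.map {R : Type w} [Semigroup R] (h : SemigroupDivides T R) (θ : T →ₙ* S)
    (hθ : Function.Surjective θ) : SemigroupDivides S R :=
  let ⟨V, η, hη⟩ := h
  ⟨V, θ.comp η, hθ.comp hη⟩

theorem complexity_le_iff (k : ℕ) :
    complexity S ≤ k ↔ ∃ n ≤ k, ∃ W, IsIteratedWreath n W ∧ SemigroupDivides S W.semi := by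
  constructor
  · intro h
    have hne : {c : ℕ∞ | ∃ (n : ℕ) (W : TS.{0}), IsIteratedWreath n W ∧
        SemigroupDivides S W.semi ∧ c = n}.Nonempty := by
      by_contra hne
      rw [Set.not_nonempty_iff_eq_empty] at hne
      rw [complexity, hne, sInf_empty] at h
      exact absurd h (by simp)
    obtain ⟨n, W, hW, hd, hn⟩ := csInf_mem hne
    rw [complexity, hn] at h
    exact ⟨n, by exact_mod_cast h, W, hW, hd⟩
  · rintro ⟨n, hn, W, hW, hd⟩
    have hle : complexity S ≤ n := sInf_le ⟨n, W, hW, hd, rfl⟩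
    exact hle.trans (by exact_mod_cast hn)

/-- Complexity does not increase under quotients. -/
theorem complexity_le_of_surjective (θ : T →ₙ* S) (hθ : Function.Surjective θ) {k : ℕ}
    (h : complexity T ≤ k) : complexity S ≤ k := by
  rw [complexity_le_iff] at h ⊢
  obtain ⟨n, hn, W, hW, hd⟩ := h
  exact ⟨n, hn, W, hW, hd.map θ hθ⟩

end Powers

/-! ### Division of wreath products and direct products -/

theorem wreathAct_eq_some {P : Type u} {Q : Type v} {f : Q → PT P} {s : PT Q} {p p' : P}
    {q q' : Q} : wreathAct f s (p, q) = some (p', q') ↔ s q = some q' ∧ f q p = some p' := by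
  simp only [wreathAct, Option.bind_eq_some_iff, Option.map_eq_some_iff, Prod.mk.injEq]
  constructor
  · rintro ⟨_, h, _, h', rfl, rfl⟩
    exact ⟨h, h'⟩
  · rintro ⟨h, h'⟩
    exact ⟨_, h, _, h', rfl, rfl⟩

theorem prodAct_eq_some {P : Type u} {Q : Type v} {t : PT P} {s : PT Q} {p p' : P}
    {q q' : Q} : prodAct t s (p, q) = some (p', q') ↔ t p = some p' ∧ s q = some q' := by
  simp only [prodAct, Option.bind_eq_some_iff, Option.map_eq_some_iff, Prod.mk.injEq]
  constructor
  · rintro ⟨_, h, _, h', rfl, rfl⟩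
    exact ⟨h, h'⟩
  · rintro ⟨h, h'⟩
    exact ⟨_, h, _, h', rfl, rfl⟩

theorem PT.mul_eq_some {Q : Type u} {f g : PT Q} {q q' : Q} :
    (f * g) q = some q' ↔ ∃ r, f q = some r ∧ g r = some q' := by
  rw [PT.mul_apply, Option.bind_eq_some_iff]

theorem PT.ext_iff_some {Q : Type u} {f g : PT Q}
    (h : ∀ q q', f q = some q' ↔ g q = some q') : f = g := by
  ext1
  funext q
  exact Option.ext fun q' => h q q'

/-- The partial function on pairs with components `φ` and `ψ`, defined where both of them are. -/
def pairPartial {P : Type u} {Q : Type v} {P' : Type w} {Q' : Type x} (φ : P' → Option P)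
    (ψ : Q' → Option Q) (z : P' × Q') : Option (P × Q) :=
  (φ z.1).bind fun p => (ψ z.2).map fun q => (p, q)

theorem pairPartial_eq_some {P : Type u} {Q : Type v} {P' : Type w} {Q' : Type x}
    {φ : P' → Option P} {ψ : Q' → Option Q} {y : P'} {z : Q'} {p : P} {q : Q} :
    pairPartial φ ψ (y, z) = some (p, q) ↔ φ y = some p ∧ ψ z = some q := by
  simp only [pairPartial, Option.bind_eq_some_iff, Option.map_eq_some_iff, Prod.mk.injEq]
  constructor
  · rintro ⟨_, h, _, h', rfl, rfl⟩
    exact ⟨h, h'⟩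
  · rintro ⟨h, h'⟩
    exact ⟨_, h, _, h', rfl, rfl⟩

namespace TS

variable {X : TS.{u}} {Y : TS.{v}} {Z : TS.{w}}

theorem Divides.trans (hXY : X.Divides Y) (hYZ : Y.Divides Z) : X.Divides Z := by
  obtain ⟨φ, hφ, hc⟩ := hXY
  obtain ⟨ψ, hψ, hd⟩ := hYZ
  refine ⟨fun z => (ψ z).bind φ, fun p => ?_, fun s hs => ?_⟩
  · obtain ⟨y, hy⟩ := hφ p
    obtain ⟨z, hz⟩ := hψ y
    exact ⟨z, Option.bind_eq_some_iff.2 ⟨y, hz, hy⟩⟩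
  · obtain ⟨t, ht, hst⟩ := hc s hs
    obtain ⟨r, hr, htr⟩ := hd t ht
    refine ⟨r, hr, fun z p p' hz hp => ?_⟩
    obtain ⟨y, hy, hyp⟩ := Option.bind_eq_some_iff.1 hz
    obtain ⟨y', hy', hyp'⟩ := hst y p p' hyp hp
    obtain ⟨z', hz', hzy'⟩ := htr z y y' hy hy'
    exact ⟨z', hz', Option.bind_eq_some_iff.2 ⟨y', hzy', hyp'⟩⟩

/-- Division by means of a covering function which is defined everywhere. -/
theorem Divides.of_fun (F : Y.State → X.State) (hF : Function.Surjective F)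
    (h : ∀ s ∈ X.semi, ∃ t ∈ Y.semi, ∀ y p', s (F y) = some p' →
      ∃ y', t y = some y' ∧ F y' = p') : X.Divides Y := by
  refine ⟨fun y => some (F y), fun p => ?_, fun s hs => ?_⟩
  · obtain ⟨y, rfl⟩ := hF p
    exact ⟨y, rfl⟩
  · obtain ⟨t, ht, hst⟩ := h s hs
    refine ⟨t, ht, fun y p p' hy hp => ?_⟩
    obtain rfl := Option.some_inj.1 hy
    obtain ⟨y', hy', rfl⟩ := hst y p' hp
    exact ⟨y', hy', rfl⟩

theorem Divides.refl (X : TS.{u}) : X.Divides X :=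
  .of_fun id Function.surjective_id fun s hs => ⟨s, hs, fun _ _ h => ⟨_, h, rfl⟩⟩

/-- The wreath product is monotone with respect to division. Some transformation of the new left
factor is needed as a value at the states where a covering transformation has the larger domain. -/
theorem Divides.wreath {X' : TS.{w}} {Y' : TS.{x}} (hX : X.Divides X') (hY : Y.Divides Y')
    (hne : ∃ t, t ∈ X'.semi) : (X.wreath Y).Divides (X'.wreath Y') := by
  classical
  obtain ⟨φ, hφ, hc⟩ := hX
  obtain ⟨ψ, hψ, hd⟩ := hY
  obtain ⟨t₀, ht₀⟩ := hne
  have hc' : ∀ s : PT X.State, ∃ t : PT X'.State, s ∈ X.semi → t ∈ X'.semi ∧ ∀ y p p',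
      φ y = some p → s p = some p' → ∃ y', t y = some y' ∧ φ y' = some p' := fun s =>
    if hs : s ∈ X.semi then (hc s hs).imp fun _ h _ => h else ⟨t₀, fun h => absurd h hs⟩
  choose c hcc using hc'
  refine ⟨pairPartial φ ψ, ?_, ?_⟩
  · rintro ⟨p, q⟩
    obtain ⟨y, hy⟩ := hφ p
    obtain ⟨z, hz⟩ := hψ q
    exact ⟨(y, z), pairPartial_eq_some.2 ⟨hy, hz⟩⟩
  · rintro _ ⟨s, hs, f, hf, rfl⟩
    obtain ⟨t, ht, hst⟩ := hd s hs
    refine ⟨wreathAct (fun z => (ψ z).elim t₀ fun q => if (s q).isSome then c (f q) else t₀) t,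
      ⟨t, ht, _, fun z _ => ?_, rfl⟩, ?_⟩
    · cases ψ z with
      | none => exact ht₀
      | some q =>
        simp only [Option.elim_some]
        split_ifs with h
        · exact (hcc _ (hf q h)).1
        · exact ht₀
    · rintro ⟨y, z⟩ ⟨p, q⟩ ⟨p', q'⟩ hyz hpq
      obtain ⟨hq, hp⟩ := wreathAct_eq_some.1 hpq
      obtain ⟨hp₁, hq₁⟩ := pairPartial_eq_some.1 hyz
      obtain ⟨z', hz', hzq'⟩ := hst z q q' hq₁ hq
      obtain ⟨y', hy', hyp'⟩ := (hcc (f q) (hf q (by simp [hq]))).2 y p p' hp₁ hp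
      refine ⟨(y', z'), wreathAct_eq_some.2 ⟨hz', ?_⟩, pairPartial_eq_some.2 ⟨hyp', hzq'⟩⟩
      simpa [hq₁, hq] using hy'

/-- The direct product is monotone with respect to division. -/
theorem Divides.prod {X' : TS.{w}} {Y' : TS.{x}} (hX : X.Divides X') (hY : Y.Divides Y') :
    (X.prod Y).Divides (X'.prod Y') := by
  obtain ⟨φ, hφ, hc⟩ := hX
  obtain ⟨ψ, hψ, hd⟩ := hY
  refine ⟨pairPartial φ ψ, ?_, ?_⟩
  · rintro ⟨p, q⟩
    obtain ⟨y, hy⟩ := hφ p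
    obtain ⟨z, hz⟩ := hψ q
    exact ⟨(y, z), pairPartial_eq_some.2 ⟨hy, hz⟩⟩
  · rintro _ ⟨r, hr, s, hs, rfl⟩
    obtain ⟨r', hr', hrr⟩ := hc r hr
    obtain ⟨s', hs', hss⟩ := hd s hs
    refine ⟨prodAct r' s', ⟨r', hr', s', hs', rfl⟩, ?_⟩
    rintro ⟨y, z⟩ ⟨p, q⟩ ⟨p', q'⟩ hyz hpq
    obtain ⟨hp, hq⟩ := prodAct_eq_some.1 hpq
    obtain ⟨hp₁, hq₁⟩ := pairPartial_eq_some.1 hyz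
    obtain ⟨y', hy', hyp'⟩ := hrr y p p' hp₁ hp
    obtain ⟨z', hz', hzq'⟩ := hss z q q' hq₁ hq
    exact ⟨(y', z'), prodAct_eq_some.2 ⟨hy', hz'⟩, pairPartial_eq_some.2 ⟨hyp', hzq'⟩⟩

theorem prod_comm_divides (X : TS.{u}) (Y : TS.{v}) : (X.prod Y).Divides (Y.prod X) := by
  refine .of_fun Prod.swap (Prod.swap_surjective) ?_
  rintro _ ⟨r, hr, s, hs, rfl⟩
  refine ⟨prodAct s r, ⟨s, hs, r, hr, rfl⟩, ?_⟩
  rintro ⟨y, z⟩ ⟨p, q⟩ h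
  obtain ⟨hp, hq⟩ := prodAct_eq_some.1 h
  exact ⟨(q, p), prodAct_eq_some.2 ⟨hq, hp⟩, rfl⟩

theorem prod_divides_wreath (X : TS.{u}) (Y : TS.{v}) : (X.prod Y).Divides (X.wreath Y) := by
  refine .of_fun id Function.surjective_id ?_
  rintro _ ⟨r, hr, s, hs, rfl⟩
  refine ⟨wreathAct (fun _ => r) s, ⟨s, hs, _, fun _ _ => hr, rfl⟩, ?_⟩
  rintro ⟨y, z⟩ ⟨p, q⟩ h
  obtain ⟨hp, hq⟩ := prodAct_eq_some.1 h
  exact ⟨(p, q), wreathAct_eq_some.2 ⟨hq, hp⟩, rfl⟩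

theorem wreath_prod_divides (X : TS.{u}) (Y : TS.{v}) (Z : TS.{w}) :
    ((X.wreath Y).prod Z).Divides (X.wreath (Y.prod Z)) := by
  refine .of_fun (fun z => ((z.1, z.2.1), z.2.2)) (fun z => ⟨(z.1.1, z.1.2, z.2), rfl⟩) ?_
  rintro _ ⟨_, ⟨r, hr, f, hf, rfl⟩, s, hs, rfl⟩
  refine ⟨wreathAct (fun q => f q.1) (prodAct r s), ⟨_, ⟨r, hr, s, hs, rfl⟩, _, ?_, rfl⟩, ?_⟩
  · rintro ⟨q, z⟩ h
    obtain ⟨⟨q', z'⟩, h⟩ := Option.isSome_iff_exists.1 h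
    exact hf q (by simp [(prodAct_eq_some.1 h).1])
  · rintro ⟨y, q, z⟩ ⟨⟨y', q'⟩, z'⟩ h
    obtain ⟨h, hz⟩ := prodAct_eq_some.1 h
    obtain ⟨hq, hy⟩ := wreathAct_eq_some.1 h
    exact ⟨(y', q', z'), wreathAct_eq_some.2 ⟨prodAct_eq_some.2 ⟨hq, hz⟩, hy⟩, rfl⟩

end TS

theorem groupTS_semi_nonempty (H : Type u) [Group H] (hH : Finite H) :
    ∃ t, t ∈ (groupTS H hH).semi :=
  ⟨_, 1, rfl⟩

theorem groupTS_divides_wreath (H : Type u) [Group H] (hH : Finite H) (Y : TS.{v})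
    [Nonempty Y.State] {e : PT Y.State} (he : e ∈ Y.semi) (he' : ∀ q, e q = some q) :
    (groupTS H hH).Divides ((groupTS H hH).wreath Y) := by
  refine .of_fun Prod.fst Prod.fst_surjective fun s hs => ?_
  refine ⟨wreathAct (fun _ => s) e, ⟨e, he, _, fun _ _ => hs, rfl⟩, ?_⟩
  rintro ⟨y, z⟩ y' h
  exact ⟨(y', z), wreathAct_eq_some.2 ⟨he' z, h⟩, rfl⟩

theorem groupTS_wreath_prod_divides (H K : Type u) [Group H] [Group K] (hH : Finite H)
    (hK : Finite K) (Y : TS.{v}) (Z : TS.{w}) :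
    (((groupTS H hH).wreath Y).prod ((groupTS K hK).wreath Z)).Divides
      ((groupTS (H × K) inferInstance).wreath (Y.prod Z)) := by
  refine .of_fun (fun z => ((z.1.1, z.2.1), (z.1.2, z.2.2)))
    (fun z => ⟨((z.1.1, z.2.1), (z.1.2, z.2.2)), rfl⟩) ?_
  rintro _ ⟨_, ⟨r, hr, f, hf, rfl⟩, _, ⟨s, hs, g, hg, rfl⟩, rfl⟩
  choose! f' hf' using hf
  choose! g' hg' using hg
  refine ⟨wreathAct (fun q => ⟨fun y : H × K => some (y * (f' q.1, g' q.2))⟩) (prodAct r s),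
    ⟨_, ⟨r, hr, s, hs, rfl⟩, _, fun q _ => ⟨_, rfl⟩, rfl⟩, ?_⟩
  rintro ⟨⟨y₁, y₂⟩, q₁, q₂⟩ ⟨⟨z₁, r₁⟩, z₂, r₂⟩ h
  obtain ⟨h₁, h₂⟩ := prodAct_eq_some.1 h
  obtain ⟨hq₁, hy₁⟩ := wreathAct_eq_some.1 h₁
  obtain ⟨hq₂, hy₂⟩ := wreathAct_eq_some.1 h₂
  rw [hf' q₁ (by simp [hq₁])] at hy₁
  rw [hg' q₂ (by simp [hq₂])] at hy₂
  obtain rfl := Option.some_inj.1 hy₁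
  obtain rfl := Option.some_inj.1 hy₂
  exact ⟨((_, _), (_, _)), wreathAct_eq_some.2 ⟨prodAct_eq_some.2 ⟨hq₁, hq₂⟩, rfl⟩, rfl⟩

/-! ### Iterated wreath products and tuples of states -/

instance PT.instFinite (Q : Type u) [Finite Q] : Finite (PT Q) :=
  Finite.of_injective PT.app fun _ _ h => PT.ext h

theorem TS.finite_semi (X : TS.{u}) : Finite X.semi :=
  have := X.finite
  inferInstance

theorem powStable_coe_iff {S : Type u} [Semigroup S] {V : Subsemigroup S} {y : V} :
    PowStable y ↔ PowStable (y : S) := by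
  refine ⟨PowStable.map (MulMemClass.subtype V), ?_⟩
  rintro ⟨m, hm⟩
  refine ⟨m, Subtype.coe_injective ?_⟩
  have h := map_spow (MulMemClass.subtype V) y
  exact (h m).trans (hm.trans (h (m + 1)).symm)

/-- The nowhere defined transformation. -/
def PT.empty (Q : Type u) : PT Q := ⟨fun _ => none⟩

theorem PT.mul_empty {Q : Type u} (f : PT Q) : f * PT.empty Q = PT.empty Q :=
  PT.ext_iff_some fun q q' => by simp [PT.mul_eq_some, PT.empty]

theorem PT.empty_mul {Q : Type u} (f : PT Q) : PT.empty Q * f = PT.empty Q := rfl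

/-- The componentwise action on tuples of states. A component where the action is undefined becomes
`none`, so that the action on tuples is defined everywhere. -/
def tupleAct {I : Type u} {P : Type v} (f : I → PT P) : PT (I → Option P) :=
  ⟨fun y => some fun i => (y i).bind (f i)⟩

theorem tupleAct_mul {I : Type u} {P : Type v} (f g : I → PT P) :
    tupleAct f * tupleAct g = tupleAct fun i => f i * g i := by
  ext1
  funext y
  change some _ = some _
  congr 1
  funext i
  change ((y i).bind (f i)).bind (g i) = (y i).bind fun r => (f i r).bind (g i)
  cases y i <;> rfl

theorem spow_tupleAct {I : Type u} {P : Type v} (f : I → PT P) (m : ℕ) :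
    spow (tupleAct f) m = tupleAct fun i => spow (f i) m := by
  induction m with
  | zero => rfl
  | succ m ih => rw [spow_succ, ih, tupleAct_mul]; rfl

namespace TS

/-- The tuples of states of `X`, acted upon by tuples whose components are arbitrary
transformations of `X` or empty. -/
def tuple (X : TS.{u}) (I : Type u) [Finite I] : TS.{u} where
  State := I → Option X.State
  finite := by
    have := X.finite
    infer_instance
  semi :=
    { carrier := {h | ∃ f : I → PT X.State,
        (∀ i, f i ∈ X.semi ∨ f i = PT.empty _) ∧ h = tupleAct f}
      mul_mem' := by
        rintro _ _ ⟨f, hf, rfl⟩ ⟨g, hg, rfl⟩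
        refine ⟨_, fun i => ?_, tupleAct_mul f g⟩
        rcases hf i with h | h
        · rcases hg i with h' | h'
          · exact Or.inl (X.semi.mul_mem h h')
          · exact Or.inr (by rw [h', PT.mul_empty])
        · exact Or.inr (by rw [h, PT.empty_mul]) }

/-- The tuples of states of `X`, acted upon diagonally by the transformations of `X`. -/
def diag (X : TS.{u}) (I : Type u) [Finite I] : TS.{u} where
  State := I → Option X.State
  finite := by
    have := X.finite
    infer_instance
  semi :=
    { carrier := {h | ∃ t ∈ X.semi, h = tupleAct fun _ => t}
      mul_mem' := by
        rintro _ _ ⟨s, hs, rfl⟩ ⟨t, ht, rfl⟩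
        exact ⟨s * t, X.semi.mul_mem hs ht, tupleAct_mul _ _⟩ }

theorem isAperiodic_tuple {A : TS.{u}} (hA : IsAperiodic A.semi) (I : Type u) [Finite I] :
    IsAperiodic (A.tuple I).semi := by
  have := A.finite_semi
  refine isAperiodic_of_powStable ?_
  rintro ⟨_, f, hf, rfl⟩
  rw [powStable_coe_iff]
  have hs : ∀ i, PowStable (f i) := fun i => by
    rcases hf i with h | h
    · exact powStable_coe_iff.1 (hA.powStable ⟨f i, h⟩)
    · exact powStable_of_mul_self (by rw [h, PT.empty_mul])
  choose m hm using hs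
  have := Fintype.ofFinite I
  refine ⟨∑ i, m i, ?_⟩
  change spow (tupleAct f) _ = spow (tupleAct f) _
  rw [spow_tupleAct, spow_tupleAct]
  congr 1
  funext i
  exact spow_eq_spow_succ_of_le (hm i)
    (Finset.single_le_sum (f := m) (fun _ _ => Nat.zero_le _) (Finset.mem_univ i))

theorem empty_mem_tuple (X : TS.{u}) (I : Type u) [Finite I] :
    tupleAct (fun _ => PT.empty _) ∈ (X.tuple I).semi :=
  ⟨_, fun _ => Or.inr rfl, rfl⟩

theorem divides_tuple (X : TS.{u}) : X.Divides (X.tuple PUnit) := by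
  refine ⟨fun y => y PUnit.unit, fun p => ⟨fun _ => some p, rfl⟩, fun s hs => ?_⟩
  refine ⟨_, ⟨fun _ => s, fun _ => Or.inl hs, rfl⟩, fun y p p' hy hp => ⟨_, rfl, ?_⟩⟩
  exact Option.bind_eq_some_iff.2 ⟨p, hy, hp⟩

theorem diag_divides_tuple (X : TS.{u}) (I : Type u) [Finite I] :
    (X.diag I).Divides (X.tuple I) := by
  refine .of_fun id Function.surjective_id ?_
  rintro _ ⟨t, ht, rfl⟩
  exact ⟨_, ⟨fun _ => t, fun _ => Or.inl ht, rfl⟩, fun _ _ h => ⟨_, h, rfl⟩⟩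

/-- The transformation semigroup consisting of a single idempotent transformation. -/
def single (P : Type u) [hP : Finite P] (e : PT P) (he : e * e = e) : TS.{u} where
  State := P
  finite := hP
  semi :=
    { carrier := {t | t = e}
      mul_mem' := fun {s t} (hs : s = e) (ht : t = e) => (congrArg₂ (· * ·) hs ht).trans he }

theorem isAperiodic_single (P : Type u) [Finite P] (e : PT P) (he : e * e = e) :
    IsAperiodic (single P e he).semi := by
  refine isAperiodic_of_powStable ?_
  have h : ∀ t : PT P, t = e → t * t = t := fun t ht => by rw [ht, he]
  exact fun t => powStable_coe_iff.2 (powStable_of_mul_self (h t.1 t.2))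

/-- The finite set `P` with the identity transformation. -/
def discrete (P : Type u) [Finite P] : TS.{u} := single P ⟨some⟩ rfl

theorem isAperiodic_discrete (P : Type u) [Finite P] : IsAperiodic (discrete P).semi :=
  isAperiodic_single _ _ _

/-- One point, with the identity and the empty transformation. Wreath multiplication with it from
the left allows to restrict the domains of transformations. -/
def point : TS.{0} where
  State := Unit
  finite := inferInstance
  semi := ⊤

theorem isAperiodic_point : IsAperiodic point.semi := by
  refine isAperiodic_of_powStable ?_
  rintro ⟨f, _⟩
  refine powStable_coe_iff.2 (powStable_of_mul_self ?_)
  change PT Unit at f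
  change f * f = f
  refine PT.ext_iff_some fun _ _ => ?_
  rw [PT.mul_eq_some]
  exact ⟨fun ⟨_, h, _⟩ => h, fun h => ⟨_, h, h⟩⟩

/-- A tuple over `H` which is moved by right translations is represented by its initial value and
the accumulated translation. -/
theorem diag_group_divides (H : Type u) [Group H] (hH : Finite H) (I : Type u) [Finite I] :
    ((groupTS H hH).diag I).Divides ((discrete (I → Option H)).wreath (groupTS H hH)) := by
  refine .of_fun (fun (z : (I → Option H) × H) i => (z.1 i).map fun y => (y * z.2 : H))
    (fun y => ⟨(y, (1 : H)), ?_⟩) ?_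
  · funext i
    change (y i).map (fun z : H => z * 1) = y i
    simp only [mul_one]
    exact Option.map_id'
  · rintro _ ⟨_, ⟨h, rfl⟩, rfl⟩
    refine ⟨wreathAct (fun _ => ⟨some⟩) ⟨fun y : H => some (y * h)⟩,
      ⟨_, ⟨h, rfl⟩, _, fun _ _ => rfl, rfl⟩, ?_⟩
    rintro ⟨c, (y : H)⟩ z hz
    refine ⟨(c, (y * h : H)), wreathAct_eq_some.2 ⟨rfl, rfl⟩, ?_⟩
    rw [← Option.some_inj.1 hz]
    funext i
    change (c i).map (fun z : H => z * (y * h)) =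
      ((c i).map fun z : H => z * y).bind fun z => some (z * h)
    cases c i
    · rfl
    · simp [mul_assoc]

/-- Tuples of pairs are represented by pairs of tuples. The state tuple of `Y` determines which
transformations of `X` act on the components; they are empty where `Y` is undefined. -/
theorem diag_wreath_divides (X Y : TS.{u}) (I : Type u) [Finite I] :
    ((X.wreath Y).diag I).Divides ((X.tuple I).wreath (Y.diag I)) := by
  classical
  refine .of_fun (fun z i => pairPartial id id (z.1 i, z.2 i))
    (fun y => ⟨(fun i => (y i).map Prod.fst, fun i => (y i).map Prod.snd), ?_⟩) ?_
  · funext i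
    change pairPartial id id ((y i).map Prod.fst, (y i).map Prod.snd) = y i
    cases y i <;> rfl
  · rintro _ ⟨_, ⟨s, hs, f, hf, rfl⟩, rfl⟩
    refine ⟨wreathAct (fun y : I → Option Y.State => tupleAct fun i => (y i).elim (PT.empty _)
      fun q => if (s q).isSome then f q else PT.empty _) (tupleAct fun _ => s),
      ⟨_, ⟨s, hs, rfl⟩, _, fun y _ => ⟨_, fun i => ?_, rfl⟩, rfl⟩, ?_⟩
    · cases y i with
      | none => exact Or.inr rfl
      | some q =>
        simp only [Option.elim_some]
        split_ifs with h
        · exact Or.inl (hf q h)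
        · exact Or.inr rfl
    · rintro ⟨y, z⟩ r hr
      refine ⟨(_, _), wreathAct_eq_some.2 ⟨rfl, rfl⟩, ?_⟩
      rw [← Option.some_inj.1 hr]
      funext i
      dsimp only
      generalize y i = yi
      generalize z i = zi
      cases zi with
      | none => cases yi <;> rfl
      | some q =>
        cases yi with
        | none => rfl
        | some p =>
          change pairPartial id id ((if (s q).isSome then f q else PT.empty _) p, s q) =
            wreathAct f s (p, q)
          simp only [pairPartial, wreathAct]
          cases hq : s q with
          | none => simp [PT.empty]
          | some q' => cases hp : f q p <;> simp [hp]

theorem diag_group_wreath_divides (H : Type u) [Group H] (hH : Finite H) (Y : TS.{u})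
    (I : Type u) [Finite I] : (((groupTS H hH).wreath Y).diag I).Divides
      ((groupTS (I → H) inferInstance).wreath (Y.diag I)) := by
  refine .of_fun (fun (z : (I → H) × (I → Option Y.State)) i => (z.2 i).map fun q => (z.1 i, q))
    (fun y => ⟨(fun i => ((y i).map fun z => (z.1 : H)).getD 1, fun i => (y i).map Prod.snd), ?_⟩)
    ?_
  · funext i
    dsimp only
    cases y i <;> rfl
  · rintro _ ⟨_, ⟨s, hs, f, hf, rfl⟩, rfl⟩
    choose! f' hf' using hf
    refine ⟨wreathAct (fun y : I → Option Y.State =>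
      (⟨fun z : I → H => some (z * fun i => ((y i).map f').getD 1)⟩ : PT (I → H)))
      (tupleAct fun _ => s), ⟨_, ⟨s, hs, rfl⟩, _, fun y _ => ⟨_, rfl⟩, rfl⟩, ?_⟩
    rintro ⟨y, z⟩ r hr
    refine ⟨(_, _), wreathAct_eq_some.2 ⟨rfl, rfl⟩, ?_⟩
    rw [← Option.some_inj.1 hr]
    funext i
    change ((z i).bind s).map (fun q' => ((y i * ((z i).map f').getD 1 : H), q')) =
      ((z i).map fun q => (y i, q)).bind (wreathAct f s)
    generalize y i = yi
    generalize z i = zi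
    cases zi with
    | none => rfl
    | some q =>
      change (s q).map (fun q' => ((yi * f' q : H), q')) = wreathAct f s (yi, q)
      simp only [wreathAct]
      cases hq : s q with
      | none => rfl
      | some q' =>
        rw [hf' q (by simp [hq])]
        rfl

end TS

/-- If `W` is an iterated wreath product, then the diagonal action on tuples of its states divides
an iterated wreath product with the same number of group factors. -/
theorem IsIteratedWreath.exists_diag_divides {n : ℕ} {W : TS.{0}} (hW : IsIteratedWreath n W)
    (I : Type) [Finite I] : ∃ W', IsIteratedWreath n W' ∧ (W.diag I).Divides W' := by
  induction hW with
  | aperiodic A hA => exact ⟨_, .aperiodic _ (TS.isAperiodic_tuple hA I), A.diag_divides_tuple I⟩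
  | group H hH =>
    exact ⟨_, .aperiodic_wreath _ (TS.isAperiodic_discrete _) (.group H hH),
      TS.diag_group_divides H hH I⟩
  | aperiodic_wreath A hA _ ih =>
    obtain ⟨W', hW', hd⟩ := ih
    exact ⟨_, .aperiodic_wreath _ (TS.isAperiodic_tuple hA I) hW',
      (TS.diag_wreath_divides _ _ I).trans
        ((TS.Divides.refl _).wreath hd ⟨_, A.empty_mem_tuple I⟩)⟩
  | group_wreath H hH _ ih =>
    obtain ⟨W', hW', hd⟩ := ih
    exact ⟨_, .group_wreath (I → H) inferInstance hW',
      (TS.diag_group_wreath_divides H hH _ I).trans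
        ((TS.Divides.refl _).wreath hd (groupTS_semi_nonempty _ _))⟩

/-- A division of semigroups can be realized by a division of transformation semigroups. A state
of `X` is represented by a state `p` and the tuple `(q v)_q` which records an element `v` of the
dividing subsemigroup that has been applied to `p`; the flag `false` marks the states where nothing
has been applied yet. -/
theorem SemigroupDivides.divides_wreath_diag {X : TS.{u}} {W : TS.{0}} {N : ℕ}
    (e : X.State ≃ Fin N) [Finite W.State] (h : SemigroupDivides X.semi W.semi) :
    X.Divides ((TS.single (Fin N × Bool) ⟨fun z => some (z.1, true)⟩ rfl).wreath
      (W.diag W.State)) := by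
  classical
  obtain ⟨V, θ, hθ⟩ := h
  let ψ : (Fin N × Bool) × (W.State → Option W.State) → Option X.State := fun z =>
    if z.1.2 then
      if h : ∃ v : V, v.1.1.app = z.2 then (θ h.choose).1 (e.symm z.1.1) else none
    else if z.2 = some then some (e.symm z.1.1) else none
  have hψ : ∀ (v : V) i, ψ ((i, true), v.1.1.app) = (θ v).1 (e.symm i) := by
    intro v i
    have hv : ∃ v' : V, v'.1.1.app = v.1.1.app := ⟨v, rfl⟩
    have : hv.choose = v := Subtype.ext (Subtype.ext (PT.ext hv.choose_spec))
    simp only [ψ, if_true, dif_pos hv, this]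
  refine ⟨ψ, fun p => ⟨((e p, false), some), by simp [ψ]⟩, fun s hs => ?_⟩
  obtain ⟨v, hv⟩ := hθ ⟨s, hs⟩
  refine ⟨wreathAct (fun _ => ⟨fun z => some (z.1, true)⟩) (tupleAct fun _ => v.1.1),
    ⟨_, ⟨_, v.1.2, rfl⟩, _, fun _ _ => rfl, rfl⟩, ?_⟩
  rintro ⟨⟨i, b⟩, y⟩ p p' hp hs'
  refine ⟨((i, true), fun q => (y q).bind v.1.1), wreathAct_eq_some.2 ⟨rfl, rfl⟩, ?_⟩
  have hs : (θ v).1 = s := congrArg Subtype.val hv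
  cases b with
  | true =>
    by_cases hy : ∃ v' : V, v'.1.1.app = y
    · obtain ⟨v', rfl⟩ := hy
      rw [hψ] at hp
      refine (hψ (v' * v) i).trans ?_
      rw [map_mul]
      exact PT.mul_eq_some.2 ⟨p, hp, by rw [hs]; exact hs'⟩
    · have hn : ψ ((i, true), y) = none := dif_neg hy
      exact absurd (hn.symm.trans hp) (by simp)
  | false =>
    by_cases hy : y = some
    · subst hy
      have hp' : e.symm i = p := by simpa [ψ] using hp
      refine (hψ v i).trans ?_
      rw [hs, hp', hs']
    · have hn : ψ ((i, false), y) = none := if_neg hy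
      exact absurd (hn.symm.trans hp) (by simp)

/-- A transformation semigroup whose semigroup divides that of an iterated wreath product divides,
as a transformation semigroup, an iterated wreath product with the same number of group factors. -/
theorem IsIteratedWreath.exists_divides {n : ℕ} {W : TS.{0}} (hW : IsIteratedWreath n W)
    {X : TS.{u}} (h : SemigroupDivides X.semi W.semi) :
    ∃ W', IsIteratedWreath n W' ∧ X.Divides W' := by
  have := X.finite
  have := W.finite
  obtain ⟨N, ⟨e⟩⟩ := Finite.exists_equiv_fin X.State
  obtain ⟨W', hW', hd⟩ := hW.exists_diag_divides W.State
  exact ⟨_, .aperiodic_wreath _ (TS.isAperiodic_single _ _ _) hW',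
    (h.divides_wreath_diag e).trans ((TS.Divides.refl _).wreath hd ⟨_, rfl⟩)⟩

/-- Division of transformation semigroups allows a covering transformation to have a larger domain
than the covered one, so it need not give a division of semigroups. After wreath multiplication
with `point` domains can be cut down, and covers can be chosen to be exact. -/
theorem TS.Divides.semigroupDivides {X : TS.{u}} {Y : TS.{0}} (h : X.Divides Y) :
    SemigroupDivides X.semi (point.wreath Y).semi := by
  classical
  obtain ⟨φ, hφ, hc⟩ := h
  let ψ : Unit × Y.State → Option X.State := fun z => φ z.2
  let covers : PT (Unit × Y.State) → PT X.State → Prop := fun t s =>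
    ∀ z, (t z).bind ψ = (ψ z).bind s
  have hmul : ∀ {t t' s s'}, covers t s → covers t' s' → covers (t * t') (s * s') := by
    intro t t' s s' h h' z
    have h1 : ((t * t') z).bind ψ = ((t z).bind ψ).bind s' := by
      rw [PT.mul_apply, Option.bind_assoc, Option.bind_assoc]
      exact congrArg _ (funext h')
    rw [h1, h z, Option.bind_assoc]
    rfl
  have huniq : ∀ {t s s'}, covers t s → covers t s' → s = s' := by
    intro t s s' h h'
    ext1
    funext p
    obtain ⟨y, hy⟩ := hφ p
    have := (h ((), y)).symm.trans (h' ((), y))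
    simpa [ψ, hy] using this
  let V : Subsemigroup (point.wreath Y).semi :=
    { carrier := {t | ∃ s : X.semi, covers t.1 s.1}
      mul_mem' := by
        rintro _ _ ⟨s, hs⟩ ⟨s', hs'⟩
        exact ⟨s * s', hmul hs hs'⟩ }
  have hV : ∀ v : V, covers v.1.1 v.2.choose.1 := fun v => v.2.choose_spec
  refine ⟨V, ⟨fun v => v.2.choose, fun v v' => Subtype.ext ?_⟩, ?_⟩
  · exact huniq (hV (v * v')) (hmul (hV v) (hV v'))
  · rintro ⟨s, hs⟩
    obtain ⟨t, ht, hst⟩ := hc s hs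
    -- the domain of the cover is cut down to the states where it covers something
    let f : Y.State → PT Unit := fun y =>
      ⟨fun _ => if ((φ y).bind s).isSome then some () else none⟩
    have he : covers (wreathAct f t) s := by
      rintro ⟨⟨⟩, y⟩
      refine Option.ext fun p' => ?_
      rw [Option.bind_eq_some_iff]
      constructor
      · rintro ⟨⟨⟨⟩, y'⟩, hy', hp'⟩
        obtain ⟨hy, hf⟩ := wreathAct_eq_some.1 hy'
        have hsome : ((φ y).bind s).isSome := by
          by_contra hn
          simp [f, hn] at hf
        obtain ⟨p'', hp''⟩ := Option.isSome_iff_exists.1 hsome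
        obtain ⟨p, hp, hpp⟩ := Option.bind_eq_some_iff.1 hp''
        obtain ⟨y₁, hy₁, hpy⟩ := hst y p p'' hp hpp
        obtain rfl := Option.some_inj.1 (hy₁.symm.trans hy)
        change φ y₁ = some p' at hp'
        change (φ y).bind s = some p'
        rw [hp'', ← hpy, hp']
      · intro hp'
        change (φ y).bind s = some p' at hp'
        obtain ⟨p, hp, hpp⟩ := Option.bind_eq_some_iff.1 hp'
        obtain ⟨y₁, hy₁, hpy⟩ := hst y p p' hp hpp
        exact ⟨((), y₁), wreathAct_eq_some.2 ⟨hy₁, by simp [f, hp']⟩, hpy⟩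
    let v : V := ⟨⟨wreathAct f t, t, ht, f, fun _ _ => trivial, rfl⟩, ⟨s, hs⟩, he⟩
    exact ⟨v, Subtype.ext (huniq (hV v) he)⟩

/-! ### Products of iterated wreath products -/

theorem groupTS_divides_wreath_discrete (H : Type) [Group H] (hH : Finite H) :
    (groupTS H hH).Divides ((groupTS H hH).wreath (TS.discrete Unit)) :=
  have : Nonempty (TS.discrete Unit).State := ⟨()⟩
  groupTS_divides_wreath H hH _ (e := ⟨some⟩) rfl fun _ => rfl

theorem aperiodic_prod_exists_divides {n : ℕ} {A X Y Z : TS.{0}} (hA : IsAperiodic A.semi)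
    (hZ : IsIteratedWreath n Z) (hd : (X.prod Y).Divides Z) :
    ∃ Z', IsIteratedWreath n Z' ∧ ((A.wreath X).prod Y).Divides Z' :=
  ⟨_, .aperiodic_wreath _ (TS.isAperiodic_tuple hA PUnit) hZ,
    (TS.wreath_prod_divides _ _ _).trans (A.divides_tuple.wreath hd ⟨_, A.empty_mem_tuple _⟩)⟩

theorem group_prod_exists_divides {n : ℕ} {H K : Type} [Group H] [Group K] (hH : Finite H)
    (hK : Finite K) {X Y Z : TS.{0}} (hZ : IsIteratedWreath n Z) (hd : (X.prod Y).Divides Z) :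
    ∃ Z', IsIteratedWreath (n + 1) Z' ∧
      (((groupTS H hH).wreath X).prod ((groupTS K hK).wreath Y)).Divides Z' :=
  ⟨_, .group_wreath (H × K) inferInstance hZ, (groupTS_wreath_prod_divides H K hH hK X Y).trans
    ((TS.Divides.refl _).wreath hd (groupTS_semi_nonempty _ _))⟩

/-- The direct product of two iterated wreath products divides an iterated wreath product in which
the group factors have been merged in pairs. -/
theorem IsIteratedWreath.exists_prod_divides {n m : ℕ} {X Y : TS.{0}} (hX : IsIteratedWreath n X)
    (hY : IsIteratedWreath m Y) : ∃ Z, IsIteratedWreath (max n m) Z ∧ (X.prod Y).Divides Z := by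
  have hgroup : ∀ {n : ℕ} {X : TS.{0}},
      (∀ {m : ℕ} {Y : TS.{0}}, IsIteratedWreath m Y →
        ∃ Z, IsIteratedWreath (max n m) Z ∧ (X.prod Y).Divides Z) →
      ∀ (H : Type) [Group H] (hH : Finite H) {m : ℕ} {Y : TS.{0}}, IsIteratedWreath m Y →
        ∃ Z, IsIteratedWreath (max (n + 1) m) Z ∧
          (((groupTS H hH).wreath X).prod Y).Divides Z := by
    intro n X ihX H _ hH m Y hY
    have hX : ∃ X', IsIteratedWreath (n + 1) X' ∧ ((groupTS H hH).wreath X).Divides X' := by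
      obtain ⟨Z, hZ, hd⟩ := ihX (.aperiodic _ (TS.isAperiodic_discrete Unit))
      rw [Nat.max_zero] at hZ
      refine ⟨_, .group_wreath H hH hZ, (TS.Divides.refl _).wreath (.trans ?_ hd)
        (groupTS_semi_nonempty H hH)⟩
      refine .of_fun Prod.fst (fun q => ⟨(q, ()), rfl⟩) fun s hs => ?_
      refine ⟨prodAct s ⟨some⟩, ⟨s, hs, _, rfl, rfl⟩, ?_⟩
      rintro ⟨q, ⟨⟩⟩ q' h
      exact ⟨(q', ()), prodAct_eq_some.2 ⟨h, rfl⟩, rfl⟩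
    induction hY with
    | aperiodic A hA =>
      obtain ⟨X', hX', hd⟩ := hX
      rw [Nat.max_zero]
      exact ⟨_, .aperiodic_wreath _ (TS.isAperiodic_tuple hA PUnit) hX',
        (TS.prod_comm_divides _ _).trans ((TS.prod_divides_wreath _ _).trans
          (A.divides_tuple.wreath hd ⟨_, A.empty_mem_tuple _⟩))⟩
    | group K hK =>
      obtain ⟨Z, hZ, hd⟩ := ihX (.aperiodic _ (TS.isAperiodic_discrete Unit))
      obtain ⟨Z', hZ', hd'⟩ := group_prod_exists_divides hH hK hZ hd
      rw [show max (n + 1) 1 = max n 0 + 1 from Nat.succ_max_succ n 0]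
      exact ⟨Z', hZ', ((TS.Divides.refl _).prod (groupTS_divides_wreath_discrete K hK)).trans hd'⟩
    | aperiodic_wreath A hA _ ih =>
      obtain ⟨Z, hZ, hd⟩ := ih
      obtain ⟨Z', hZ', hd'⟩ :=
        aperiodic_prod_exists_divides hA hZ ((TS.prod_comm_divides _ _).trans hd)
      exact ⟨Z', hZ', (TS.prod_comm_divides _ _).trans hd'⟩
    | group_wreath K hK hY' _ =>
      obtain ⟨Z, hZ, hd⟩ := ihX hY'
      obtain ⟨Z', hZ', hd'⟩ := group_prod_exists_divides hH hK hZ hd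
      rw [Nat.succ_max_succ]
      exact ⟨Z', hZ', hd'⟩
  have haper : ∀ {A : TS.{0}}, IsAperiodic A.semi → ∀ {m : ℕ} {Y : TS.{0}},
      IsIteratedWreath m Y → ∃ Z, IsIteratedWreath (max 0 m) Z ∧ (A.prod Y).Divides Z := by
    intro A hA m Y hY
    rw [Nat.zero_max]
    exact ⟨_, .aperiodic_wreath A hA hY, TS.prod_divides_wreath _ _⟩
  induction hX generalizing m Y with
  | aperiodic A hA => exact haper hA hY
  | group H hH =>
    obtain ⟨Z, hZ, hd⟩ := hgroup (haper (TS.isAperiodic_discrete Unit)) H hH hY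
    exact ⟨Z, hZ, ((groupTS_divides_wreath_discrete H hH).prod (.refl _)).trans hd⟩
  | aperiodic_wreath A hA _ ih =>
    obtain ⟨Z, hZ, hd⟩ := ih hY
    exact aperiodic_prod_exists_divides hA hZ hd
  | group_wreath H hH _ ih => exact hgroup (fun h => ih h) H hH hY

/-! ### Aperiodic relational morphisms onto a wreath product with a group -/

/-- `R` is a relational morphism from `S` to `N` which is aperiodic: the elements related to an
idempotent of `N` form an aperiodic semigroup. -/
structure IsAperiodicRel {S : Type u} {N : Type v} [Semigroup S] [Semigroup N]
    (R : S → N → Prop) : Prop where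
  mul : ∀ {y z n m}, R y n → R z m → R (y * z) (n * m)
  total : ∀ y, ∃ n, R y n
  powStable : ∀ {y n}, R y n → n * n = n → PowStable y

theorem IsAperiodicRel.spow {S : Type u} {N : Type v} [Semigroup S] [Semigroup N]
    {R : S → N → Prop} (hR : IsAperiodicRel R) {y : S} {n : N} (h : R y n) (m : ℕ) :
    R (spow y m) (spow n m) := by
  induction m with
  | zero => exact h
  | succ m ih => exact hR.mul ih h

/-- An aperiodic relational morphism restricts along a division. -/
theorem SemigroupDivides.exists_isAperiodicRel {S : Type u} {T : Type v} {N : Type w}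
    [Semigroup S] [Semigroup T] [Semigroup N] (h : SemigroupDivides S T) {R : T → N → Prop}
    (hR : IsAperiodicRel R) : ∃ R' : S → N → Prop, IsAperiodicRel R' := by
  obtain ⟨V, θ, hθ⟩ := h
  refine ⟨fun s n => ∃ v : V, θ v = s ∧ R v n, ?_, fun s => ?_, ?_⟩
  · rintro _ _ n m ⟨v, rfl, hv⟩ ⟨v', rfl, hv'⟩
    exact ⟨v * v', map_mul _ _ _, hR.mul hv hv'⟩
  · obtain ⟨v, rfl⟩ := hθ s
    obtain ⟨n, hn⟩ := hR.total v
    exact ⟨n, v, rfl, hn⟩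
  · rintro _ n ⟨v, rfl, hv⟩ hn
    exact (powStable_coe_iff.2 (hR.powStable hv hn)).map θ

/-- The pairs `(f, t)` which define the transformations of the wreath product of the group `H` with
`Y`, with `f` defined on all states. They form the semidirect product of `Q → H` and the semigroup
of `Y`, where `Q` is the set of states of `Y`. -/
@[ext]
structure Cocycle (H : Type u) (Y : TS.{v}) where
  /-- the function from the states to the group -/
  fn : Y.State → H
  /-- the transformation of the states -/
  tr : Y.semi

instance Cocycle.instSemigroup (H : Type u) [Group H] (Y : TS.{v}) :
    Semigroup (Cocycle H Y) where
  mul y z := ⟨fun q => y.fn q * ((y.tr.1 q).map z.fn).getD 1, y.tr * z.tr⟩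
  mul_assoc y z r := by
    refine Cocycle.ext (funext fun q => ?_) (mul_assoc _ _ _)
    change y.fn q * ((y.tr.1 q).map z.fn).getD 1 * (((y.tr.1 q).bind z.tr.1).map r.fn).getD 1 =
      y.fn q * ((y.tr.1 q).map fun q => z.fn q * ((z.tr.1 q).map r.fn).getD 1).getD 1
    cases y.tr.1 q <;> simp [mul_assoc]

theorem Cocycle.mul_fn {H : Type u} [Group H] {Y : TS.{v}} (y z : Cocycle H Y) (q : Y.State) :
    (y * z).fn q = y.fn q * ((y.tr.1 q).map z.fn).getD 1 := rfl

instance Cocycle.instFinite (H : Type u) [Finite H] (Y : TS.{v}) : Finite (Cocycle H Y) :=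
  have := Y.finite
  have := Y.finite_semi
  Finite.of_injective (fun y => (y.fn, y.tr)) fun _ _ h =>
    Cocycle.ext (congrArg Prod.fst h) (congrArg Prod.snd h)

section Wreath

variable {P : Type u} {Q : Type v}

theorem wreathAct_mul (f g : Q → PT P) (s t : PT Q) : wreathAct f s * wreathAct g t =
    wreathAct (fun q => (s q).elim (f q) fun q' => f q * g q') (s * t) := by
  refine PT.ext_iff_some ?_
  rintro ⟨p, q⟩ ⟨p', q'⟩
  rw [PT.mul_eq_some, wreathAct_eq_some, PT.mul_eq_some]
  constructor
  · rintro ⟨⟨p₁, q₁⟩, h₁, h₂⟩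
    obtain ⟨hq₁, hp₁⟩ := wreathAct_eq_some.1 h₁
    obtain ⟨hq₂, hp₂⟩ := wreathAct_eq_some.1 h₂
    refine ⟨⟨q₁, hq₁, hq₂⟩, ?_⟩
    rw [hq₁]
    exact PT.mul_eq_some.2 ⟨p₁, hp₁, hp₂⟩
  · rintro ⟨⟨q₁, hq₁, hq₂⟩, h⟩
    rw [hq₁] at h
    obtain ⟨p₁, hp₁, hp₂⟩ := PT.mul_eq_some.1 h
    exact ⟨(p₁, q₁), wreathAct_eq_some.2 ⟨hq₁, hp₁⟩, wreathAct_eq_some.2 ⟨hq₂, hp₂⟩⟩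

theorem wreathAct_congr {f g : Q → PT P} {s : PT Q} (h : ∀ q, (s q).isSome → f q = g q) :
    wreathAct f s = wreathAct g s := by
  refine PT.ext_iff_some ?_
  rintro ⟨p, q⟩ ⟨p', q'⟩
  rw [wreathAct_eq_some, wreathAct_eq_some]
  refine and_congr_right fun hq => ?_
  rw [h q (by simp [hq])]

theorem spow_wreathAct_snd {f : Q → PT P} {s : PT Q} {m : ℕ} {p p' : P} {q q' : Q}
    (h : spow (wreathAct f s) m (p, q) = some (p', q')) : spow s m q = some q' := by
  induction m generalizing p' q' with
  | zero => exact (wreathAct_eq_some.1 h).1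
  | succ m ih =>
    obtain ⟨⟨p₁, q₁⟩, h₁, h₂⟩ := PT.mul_eq_some.1 h
    exact PT.mul_eq_some.2 ⟨q₁, ih h₁, (wreathAct_eq_some.1 h₂).1⟩

theorem spow_wreathAct_of_fixed {f : Q → PT P} {s : PT Q} {q : Q} (hq : s q = some q) (m : ℕ)
    (p : P) : spow (wreathAct f s) m (p, q) = (spow (f q) m p).map fun p' => (p', q) := by
  have hone : ∀ p, wreathAct f s (p, q) = (f q p).map fun p' => (p', q) := fun p => by
    simp [wreathAct, hq]
  induction m with
  | zero => exact hone p
  | succ m ih =>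
    rw [spow_succ, spow_succ, PT.mul_apply, PT.mul_apply, ih]
    cases spow (f q) m p with
    | none => rfl
    | some p' => exact hone p'

/-- If `s` has a stable power, so has the transformation of a pair `(f, s)` with values in an
aperiodic semigroup: after finitely many steps the second component is fixed, and the first one
moves by the powers of a single element. -/
theorem powStable_wreathAct {A : TS.{u}} (hA : IsAperiodic A.semi) {f : Q → PT A.State}
    {s : PT Q} (hf : ∀ q, (s q).isSome → f q ∈ A.semi) (hs : PowStable s) :
    PowStable (wreathAct f s) := by
  have := A.finite_semi
  have := Fintype.ofFinite A.semi
  choose l hl using fun t : A.semi => powStable_coe_iff.1 (hA.powStable t)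
  obtain ⟨m, hm⟩ := hs
  refine ⟨m + (∑ t, l t) + 1, ?_⟩
  rw [show m + (∑ t, l t) + 1 + 1 = m + ((∑ t, l t) + 1) + 1 by ring, ← spow_mul_spow,
    ← spow_mul_spow]
  refine PT.ext ?_
  funext z
  rw [PT.mul_apply, PT.mul_apply]
  cases h : spow (wreathAct f s) m z with
  | none => rfl
  | some z' =>
    obtain ⟨p, q⟩ := z
    obtain ⟨p', q'⟩ := z'
    have hq := spow_wreathAct_snd h
    have hfix : s q' = some q' := by
      rw [hm] at hq
      obtain ⟨q₁, hq₁, hq₂⟩ := PT.mul_eq_some.1 hq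
      rw [← hm] at hq
      obtain rfl := Option.some_inj.1 (hq₁.symm.trans hq)
      exact hq₂
    rw [Option.bind_some, Option.bind_some, spow_wreathAct_of_fixed hfix,
      spow_wreathAct_of_fixed hfix]
    congr 2
    exact (spow_eq_spow_succ_of_le
      (hl ⟨f q', hf q' (by simp [hfix])⟩)
      (Finset.single_le_sum (f := l) (fun _ _ => Nat.zero_le _) (Finset.mem_univ _)))

/-- Wreath multiplication with an aperiodic transformation semigroup from the left does not affect
the target of an aperiodic relational morphism. -/
theorem IsAperiodicRel.wreath {A : TS.{u}} {Y : TS.{v}} {N : Type w} [Semigroup N]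
    (hA : IsAperiodic A.semi) {R : Y.semi → N → Prop} (hR : IsAperiodicRel R) :
    IsAperiodicRel fun (y : (A.wreath Y).semi) n => ∃ (s : Y.semi) (f : Y.State → PT A.State),
      (∀ q, (s.1 q).isSome → f q ∈ A.semi) ∧ y.1 = wreathAct f s.1 ∧ R s n := by
  refine ⟨?_, ?_, ?_⟩
  · rintro ⟨_, _⟩ ⟨_, _⟩ n m ⟨s, f, hf, rfl, hs⟩ ⟨t, g, hg, rfl, ht⟩
    refine ⟨s * t, _, fun q hq => ?_, wreathAct_mul f g s.1 t.1, hR.mul hs ht⟩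
    obtain ⟨q', hq'⟩ := Option.isSome_iff_exists.1 hq
    obtain ⟨q₁, hq₁, hq₂⟩ := PT.mul_eq_some.1 hq'
    rw [hq₁]
    exact A.semi.mul_mem (hf q (by simp [hq₁])) (hg q₁ (by simp [hq₂]))
  · rintro ⟨_, s, hs, f, hf, rfl⟩
    obtain ⟨n, hn⟩ := hR.total ⟨s, hs⟩
    exact ⟨n, ⟨s, hs⟩, f, hf, rfl, hn⟩
  · rintro ⟨_, _⟩ n ⟨s, f, hf, rfl, hs⟩ hn
    exact powStable_coe_iff.2
      (powStable_wreathAct hA hf (powStable_coe_iff.1 (hR.powStable hs hn)))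

theorem isAperiodicRel_group_wreath (H : Type u) [Group H] (hH : Finite H) (Y : TS.{v}) :
    IsAperiodicRel fun (y : ((groupTS H hH).wreath Y).semi) (n : Cocycle H Y) =>
      y.1 = wreathAct (fun q => (⟨fun z : H => some (z * n.fn q)⟩ : PT H)) n.tr.1 := by
  have hmul : ∀ n m : Cocycle H Y,
      wreathAct (fun q => (⟨fun z : H => some (z * n.fn q)⟩ : PT H)) n.tr.1 *
        wreathAct (fun q => (⟨fun z : H => some (z * m.fn q)⟩ : PT H)) m.tr.1 =
      wreathAct (fun q => (⟨fun z : H => some (z * (n * m).fn q)⟩ : PT H)) (n * m).tr.1 := by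
    intro n m
    rw [wreathAct_mul]
    refine wreathAct_congr fun q hq => ?_
    rw [Cocycle.mul_fn]
    cases h : n.tr.1 q with
    | none => simp [PT.mul_apply, h] at hq
    | some q' => exact PT.ext (funext fun z => by simp [PT.mul_apply, mul_assoc])
  refine ⟨?_, ?_, ?_⟩
  · rintro ⟨_, _⟩ ⟨_, _⟩ n m rfl rfl
    exact hmul n m
  · rintro ⟨_, s, hs, f, hf, rfl⟩
    have hf₁ := hf
    choose! f' hf' using hf₁
    exact ⟨⟨f', ⟨s, hs⟩⟩, wreathAct_congr hf'⟩
  · rintro ⟨_, _⟩ n rfl hn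
    refine powStable_coe_iff.2 (powStable_of_mul_self ((hmul n n).trans ?_))
    rw [hn]

end Wreath

/-- An iterated wreath product with `n` group factors admits an aperiodic relational morphism to the
semigroup of a wreath product of a group and an iterated wreath product with at most `n - 1` group
factors: the aperiodic factors to the left of the leftmost group are forgotten. A missing group, or
a missing factor to the right of it, is replaced by a trivial one. -/
theorem IsIteratedWreath.exists_isAperiodicRel {n : ℕ} {W : TS.{0}} (hW : IsIteratedWreath n W) :
    ∃ m ≤ n - 1, ∃ Y : TS.{0}, IsIteratedWreath m Y ∧ ∃ (H : Type) (_ : Group H) (_ : Finite H)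
      (R : W.semi → Cocycle H Y → Prop), IsAperiodicRel R := by
  let I : TS.{0} := TS.discrete Unit
  have hI : IsIteratedWreath 0 I := .aperiodic _ (TS.isAperiodic_discrete Unit)
  let e : I.semi := ⟨⟨some⟩, rfl⟩
  induction hW with
  | aperiodic A hA =>
    have := A.finite_semi
    exact ⟨0, le_rfl, I, hI, Unit, inferInstance, inferInstance, fun _ _ => True,
      fun _ _ => trivial, fun _ => ⟨⟨1, e⟩, trivial⟩, fun _ _ => hA.powStable _⟩
  | group H hH =>
    have hmul : ∀ h k : H, (⟨fun z => some (z * h)⟩ : PT H) * ⟨fun z => some (z * k)⟩ =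
        ⟨fun z => some (z * (h * k))⟩ := fun h k =>
      PT.ext (funext fun z => by simp [PT.mul_apply, mul_assoc])
    refine ⟨0, le_rfl, I, hI, H, inferInstance, hH, fun y n => ∃ h : H,
      y.1 = (⟨fun z => some (z * h)⟩ : PT H) ∧ n = ⟨fun _ => h, e⟩, ?_, ?_, ?_⟩
    · rintro ⟨_, _⟩ ⟨_, _⟩ _ _ ⟨h, rfl, rfl⟩ ⟨k, rfl, rfl⟩
      exact ⟨h * k, hmul h k, rfl⟩
    · rintro ⟨_, h, rfl⟩
      exact ⟨_, h, rfl, rfl⟩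
    · rintro ⟨_, _⟩ _ ⟨h, rfl, rfl⟩ hn
      have h1 : h * h = h := congrFun (congrArg Cocycle.fn hn) ()
      exact powStable_coe_iff.2 (powStable_of_mul_self ((hmul h h).trans (by rw [h1])))
  | aperiodic_wreath A hA _ ih =>
    obtain ⟨m, hm, Y, hY, H, _, hH, R, hR⟩ := ih
    exact ⟨m, hm, Y, hY, H, _, hH, _, hR.wreath hA⟩
  | @group_wreath n H _ hH W hW _ =>
    exact ⟨n, le_rfl, W, hW, H, _, hH, _, isAperiodicRel_group_wreath H hH W⟩

/-! ### The action on an `ℛ`-class of the `0`-minimal ideal -/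

/-- The action of a semigroup on itself by right multiplication. -/
def rightMul (N : Type u) [Semigroup N] : N →ₙ* PT N where
  toFun y := ⟨fun z => some (z * y)⟩
  map_mul' y z := PT.ext (funext fun r => by simp [PT.mul_apply, mul_assoc])

/-- The image of a finite semigroup under its action on itself by right multiplication. -/
def regularTS (N : Type u) [Semigroup N] [hN : Finite N] : TS.{u} where
  State := N
  finite := hN
  semi := (rightMul N).srange

namespace ReesCoordinates

variable {S : Type u} {G : Type v} {A : Type w} {B : Type x} [Semigroup S] [Group G]

/-- A right mapping semigroup acts faithfully on every `ℛ`-class of its `0`-minimal ideal. -/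
theorem act_injective (D : ReesCoordinates S G A B) (hS : IsRightMapping S) (a : A) :
    Function.Injective (D.act a) := by
  obtain ⟨X, ρ, -, hρ, htr⟩ := hS
  have hmul : ∀ s t y, ρ (s * t) y = (ρ s y).bind (ρ t) := fun s t y => by
    rw [map_mul, PT.mul_apply]
  obtain ⟨b, -⟩ := D.col_regular a
  -- a zero that acts somewhere would leave room for only one nonempty action, on one point
  have hzero : ∀ {z}, IsZeroElt z → ∀ y, ρ z y = none := by
    intro z hz y
    by_contra hne
    obtain ⟨r, hr⟩ := Option.ne_none_iff_exists'.1 hne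
    have hsub : ∀ r', r' = r := by
      intro r'
      obtain ⟨s, hs⟩ := htr r r'
      have h := hmul z s y
      rw [(hz s).1, hr, Option.bind_some, hs] at h
      exact (Option.some_inj.1 h).symm
    obtain rfl := hsub y
    cases hi : ρ (D.elt (a, 1, b)) y with
    | none =>
      have h := hmul z (D.elt (a, 1, b)) y
      rw [(hz _).1, hr, Option.bind_some, hi] at h
      exact absurd h (by simp)
    | some r' =>
      obtain rfl := hsub r'
      have h : D.elt (a, 1, b) = z := hρ <| PT.ext <| funext fun y' => by
        obtain rfl := hsub y'
        rw [hi, hr]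
      exact D.elt_ne_zero _ (h ▸ hz)
  obtain ⟨y₀, y₁, h₁⟩ : ∃ y₀ y₁, ρ (D.elt (a, 1, b)) y₀ = some y₁ := by
    by_contra! hne
    have hnone : ∀ y, ρ (D.elt (a, 1, b)) y = none := fun y =>
      Option.eq_none_iff_forall_ne_some.2 (hne y)
    refine D.elt_ne_zero (a, 1, b) fun s => ⟨hρ ?_, hρ ?_⟩ <;> refine PT.ext (funext fun y => ?_)
    · rw [hmul, hnone, Option.bind_none]
    · rw [hmul, hnone]
      cases ρ s y <;> simp [hnone]
  have hkey : ∀ {s t} z z', D.act a s = D.act a t → D.elt (a, z) * s = D.elt (a, z') →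
      D.elt (a, z) * t = D.elt (a, z') := by
    intro s t z z' hst h
    rw [← D.actFun_eq_some] at h ⊢
    change D.actFun a s = D.actFun a t at hst
    rw [← hst, h]
  intro s t hst
  refine hρ (PT.ext (funext fun y => ?_))
  obtain ⟨r, hr⟩ := htr y₁ y
  have hy : ρ (D.elt (a, 1, b) * r) y₀ = some y := by rw [hmul, h₁]; exact hr
  rcases D.mul_cases a (1, b) r with ⟨z, hz⟩ | hz
  · rw [hz] at hy
    have hact : ∀ s, ρ s y = ρ (D.elt (a, z) * s) y₀ := fun s => by rw [hmul, hy]; rfl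
    rw [hact, hact]
    rcases D.mul_cases a z s with ⟨z', hz'⟩ | hs
    · rw [hz', hkey z z' hst hz']
    · rcases D.mul_cases a z t with ⟨z', hz'⟩ | ht
      · rw [hz', hkey z z' hst.symm hz']
      · rw [hzero hs, hzero ht]
  · exact absurd ((hzero hz y₀).symm.trans hy) (by simp)

theorem elt_mul_elt (D : ReesCoordinates S G A B) {a a' : A} {b b' : B} {g g' c : G}
    (hc : D.C b a' = some c) : D.elt (a, g, b) * D.elt (a', g', b') = D.elt (a, g * c * g', b') :=
  D.mul_some _ _ _ (by simp [reesMul, hc])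

theorem spow_elt (D : ReesCoordinates S G A B) {a : A} {b : B} {g c : G}
    (hc : D.C b a = some c) (m : ℕ) :
    spow (D.elt (a, g, b)) m = D.elt (a, (g * c) ^ m * g, b) := by
  induction m with
  | zero => simp [spow]
  | succ m ih => rw [spow_succ, ih, D.elt_mul_elt hc, pow_succ]; simp only [mul_assoc]

/-- In a maximal subgroup of the ideal only the identity has a stable power. -/
theorem mul_eq_one_of_powStable (D : ReesCoordinates S G A B) {a : A} {b : B} {g c : G}
    (hc : D.C b a = some c) (h : PowStable (D.elt (a, g, b))) : g * c = 1 := by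
  obtain ⟨m, hm⟩ := h
  rw [D.spow_elt hc, D.spow_elt hc] at hm
  have := D.elt_injective hm
  simpa [pow_succ] using this

/-- An aperiodic relational morphism to `N` separates the points of an `ℛ`-class of the ideal which
lie in the same `ℋ`-class. -/
theorem eq_of_isAperiodicRel (D : ReesCoordinates S G A B) {N : Type*} [Semigroup N] [Finite N]
    {R : S → N → Prop} (hR : IsAperiodicRel R) {a : A} {b : B} {g g' : G} {n : N}
    (h : R (D.elt (a, g, b)) n) (h' : R (D.elt (a, g', b)) n) : g = g' := by
  obtain ⟨b₀, hb₀⟩ := D.col_regular a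
  obtain ⟨c, hc⟩ := Option.ne_none_iff_exists'.1 hb₀
  obtain ⟨a', ha'⟩ := D.row_regular b
  obtain ⟨d, hd⟩ := Option.ne_none_iff_exists'.1 ha'
  -- multiplication with `elt (a', 1, b₀)` moves both points into a maximal subgroup
  obtain ⟨m, hm⟩ := hR.total (D.elt (a', 1, b₀))
  have h1 := hR.mul h hm
  have h1' := hR.mul h' hm
  rw [D.elt_mul_elt hd, mul_one] at h1 h1'
  -- an idempotent power of `n * m` is a right multiple of it; the same right multiplication takes
  -- both points to elements related to this idempotent
  obtain ⟨i, hi⟩ := exists_spow_idempotent (n * m)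
  have hidem : n * m * spow (n * m) (i + i) = spow (n * m) i := by
    change spow (n * m) 0 * spow (n * m) (i + i) = _
    rw [spow_mul_spow, zero_add, ← spow_mul_spow, hi]
  have h2 := hR.spow h1 (i + i)
  rw [D.spow_elt hc] at h2
  have h3 := hR.mul h1 h2
  have h3' := hR.mul h1' h2
  rw [D.elt_mul_elt hc, hidem] at h3 h3'
  have h4 := D.mul_eq_one_of_powStable hc (hR.powStable h3 hi)
  have h4' := D.mul_eq_one_of_powStable hc (hR.powStable h3' hi)
  simpa [mul_assoc] using h4.trans h4'.symm

/-- An aperiodic relational morphism to the semigroup `N` of pairs of a wreath product with a group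
yields a division. The point `(g, b)` is represented by the states `(n, b)` with `(a, g, b)` related
to `n ∈ N`, and `N` acts on itself as a part of a wreath product with a regular action. -/
theorem ts_divides_of_isAperiodicRel [Finite S] (D : ReesCoordinates S G A B) (a : A) {H : Type}
    [Group H] (hH : Finite H) {Y : TS.{0}} (hQ : Finite (Y.State → H)) (hY : Finite Y.semi)
    {R : S → Cocycle H Y → Prop} (hR : IsAperiodicRel R) :
    (D.ts a).Divides (((groupTS (Y.State → H) hQ).wreath (regularTS Y.semi)).prod
      (D.rlmTS a)) := by
  classical
  let φ : ((Y.State → H) × Y.semi) × B → Option (G × B) := fun z =>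
    if h : ∃ g, R (D.elt (a, g, z.2)) ⟨z.1.1, z.1.2⟩ then some (h.choose, z.2) else none
  have hφ : ∀ f t b g, R (D.elt (a, g, b)) ⟨f, t⟩ → φ ((f, t), b) = some (g, b) := by
    intro f t b g h
    have hex : ∃ g, R (D.elt (a, g, b)) ⟨f, t⟩ := ⟨g, h⟩
    have hg : hex.choose = g := D.eq_of_isAperiodicRel hR hex.choose_spec h
    simp only [φ, dif_pos hex, hg]
  refine ⟨φ, ?_, ?_⟩
  · rintro ⟨g, b⟩
    obtain ⟨⟨f, t⟩, h⟩ := hR.total (D.elt (a, g, b))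
    exact ⟨((f, t), b), hφ f t b g h⟩
  · rintro _ ⟨s, rfl⟩
    obtain ⟨n, hn⟩ := hR.total s
    refine ⟨prodAct (wreathAct (fun t : Y.semi => (⟨fun f : Y.State → H => some
      (f * fun q => ((t.1 q).map n.fn).getD 1)⟩ : PT (Y.State → H))) (rightMul Y.semi n.tr))
      (D.rlm a s), ⟨_, ⟨_, ⟨n.tr, rfl⟩, _, fun t _ => ⟨_, rfl⟩, rfl⟩, _, ⟨s, rfl⟩, rfl⟩, ?_⟩
    rintro ⟨⟨f, t⟩, b⟩ ⟨g, b₁⟩ ⟨g', b'⟩ hp hs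
    obtain ⟨g₁, hg₁, hgb⟩ : ∃ g₁, R (D.elt (a, g₁, b)) ⟨f, t⟩ ∧ (g₁, b) = (g, b₁) := by
      by_cases hex : ∃ g, R (D.elt (a, g, b)) ⟨f, t⟩
      · obtain ⟨g₁, hg₁⟩ := hex
        exact ⟨g₁, hg₁, Option.some_inj.1 ((hφ f t b g₁ hg₁).symm.trans hp)⟩
      · have hnone : φ ((f, t), b) = none := dif_neg hex
        exact absurd (hnone.symm.trans hp) (by simp)
    obtain ⟨rfl, rfl⟩ := Prod.mk.inj hgb
    have hs' : D.elt (a, g₁, b) * s = D.elt (a, g', b') := (D.actFun_eq_some ..).1 hs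
    have hR' := hR.mul hg₁ hn
    rw [hs'] at hR'
    exact ⟨_, prodAct_eq_some.2 ⟨wreathAct_eq_some.2 ⟨rfl, rfl⟩,
      (D.rlmFun_eq_some a s g₁ b b').2 ⟨g', hs⟩⟩, hφ _ _ _ _ hR'⟩

end ReesCoordinates

end KRho

theorem mainTheorem5 {S G A B : Type*} [Semigroup S] [Finite S] [Group G] [Nontrivial G]
    (hS : KRho.IsGGM S) (D : KRho.ReesCoordinates S G A B) (a : A) (k : ℕ) (hk : 0 < k) :
    KRho.complexity S ≤ (k : ℕ∞) ↔
      (D.rlmTS a).complexity ≤ (k : ℕ∞) ∧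
      ∃ (T : KRho.TS.{0}) (H : Type) (_ : Group H) (hH : Finite H),
        T.complexity ≤ ((k - 1 : ℕ) : ℕ∞) ∧
        (D.ts a).Divides (((KRho.groupTS H hH).wreath T).prod (D.rlmTS a)) := by
  constructor
  · intro h
    refine ⟨KRho.complexity_le_of_surjective (D.rlm a).srangeRestrict
      (D.rlm a).srangeRestrict_surjective h, ?_⟩
    obtain ⟨n, hn, W, hW, hd⟩ := (KRho.complexity_le_iff k).1 h
    obtain ⟨m, hm, Y, hY, H, _, hH, R₀, hR₀⟩ := hW.exists_isAperiodicRel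
    obtain ⟨R, hR⟩ := hd.exists_isAperiodicRel hR₀
    have := Y.finite
    have := Y.finite_semi
    refine ⟨KRho.regularTS Y.semi, Y.State → H, inferInstance, inferInstance, ?_,
      D.ts_divides_of_isAperiodicRel a hH _ _ hR⟩
    refine KRho.complexity_le_of_surjective (KRho.rightMul Y.semi).srangeRestrict
      (KRho.rightMul Y.semi).srangeRestrict_surjective ?_
    exact (KRho.complexity_le_iff _).2 ⟨m, by omega, Y, hY, .refl⟩
  · rintro ⟨hrlm, T, H, _, hH, hT, hd⟩
    obtain ⟨n₁, hn₁, W₁, hW₁, hd₁⟩ := (KRho.complexity_le_iff _).1 hT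
    obtain ⟨n₂, hn₂, W₂, hW₂, hd₂⟩ := (KRho.complexity_le_iff _).1 hrlm
    obtain ⟨X₁, hX₁, hTX⟩ := hW₁.exists_divides hd₁
    obtain ⟨X₂, hX₂, hBX⟩ := hW₂.exists_divides hd₂
    obtain ⟨Z, hZ, hXZ⟩ := (hX₁.group_wreath H hH).exists_prod_divides hX₂
    have hdZ : (D.ts a).Divides Z :=
      hd.trans ((((KRho.TS.Divides.refl (KRho.groupTS H hH)).wreath hTX
        (KRho.groupTS_semi_nonempty H hH)).prod hBX).trans hXZ)
    have hbij : Function.Bijective (D.act a).srangeRestrict :=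
      ⟨fun s t h => D.act_injective hS.1 a (congrArg Subtype.val h),
        (D.act a).srangeRestrict_surjective⟩
    let ε := (MulEquiv.ofBijective _ hbij).symm
    refine (KRho.complexity_le_iff k).2 ⟨max (n₁ + 1) n₂, by omega, _,
      .aperiodic_wreath _ KRho.TS.isAperiodic_point hZ,
      hdZ.semigroupDivides.map ε.toMulHom ε.surjective⟩
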